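/- **Setting.** Let $\mathcal M$ be a smooth finite-dimensional Riemannian manifold with Riemannian distance $d$, $f_1,\dots,f_n:\mathcal M\to\mathbb R$ ($n\ge1$) twice continuously differentiable, $f=\frac1n\sum_{i=1}^n f_i$. Let $R$ be a retraction (a smooth map $T\mathcal M\to\mathcal M$ with $R_x(0)=x$, $DR_x(0)=\mathrm{id}$) and $\mathcal T$ an isometric vector transport associated with $R$: linear isometries $\mathcal T_\xi:T_x\mathcal M\to T_{R_x(\xi)}\mathcal M$ with $\mathcal T_{0_x}=\mathrm{id}$. Let $\mathcal X$ be a neighbourhood of a point $x^*$ with $f(x^*)\le f(x)$ for all $x\in\mathcal X$, and let $\rho>0$ be such that for every $x\in\mathcal X$ the map $R_x$ is a diffeomorphism of the ball $\{\|\xi\|<\rho\}\subset T_x\mathcal M$ onto an open set containing $\mathcal X$. For $x,y\in\mathcal X$ let $R_x^{-1}(y)$ be the preimage of $y$ in this ball and $\mathcal T_x^y=\mathcal T_{R_x^{-1}(y)}$. Let $P_x^y$ be parallel transport (Levi-Civita) along $t\mapsto R_x(tR_x^{-1}(y))$, $0\le t\le1$, and $P_y^x$ its inverse. Assume that there are constants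 $L,L_l,G,\theta,\mu,\nu>0$ and $\sigma\ge0$ such that for all $x,y\in\mathcal X$, with $\xi=R_x^{-1}(y)$, all $v\in T_x\mathcal M$ and all $i$: - $\|\mathrm{grad} f_i(x)\|\le G$ and $\frac1n\sum_{j}\|\mathrm{grad} f_j(x)-\mathrm{grad} f(x)\|^2\le\sigma^2$; - $f(y)\le f(x)+\langle\mathrm{grad} f(x),\xi\rangle+\frac L2\|\xi\|^2$; - $\frac1n\sum_{j}\|\mathrm{grad} f_j(x)-P_y^x\,\mathrm{grad} f_j(y)\|^2\le L_l^2\|\xi\|^2$; - $\|\mathcal T_x^yv-P_x^yv\|\le\theta\|\xi\|\|v\|$; - $\|\xi\|\le\mu\,d(x,y)$ and $d(x,y)\le\nu\|\xi\|$. No curvature bound and no compactness of $\mathcal X$ is assumed. **Algorithm (R-SVRG with fixed batch size).** Input: $\tilde x^0\in\mathcal X$, step size $\eta>0$, integers $S,m,b\ge1$, $1\le B\le n$. For $s=1,\dots,S$: put $x_0^s=\tilde x^{s-1}$, draw $\mathcal B^s\subset\{1,\dots,n\}$ uniformly among the subsets of size $B$, put $v_0^s=\frac1B\sum_{i\in\mathcal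 B^s}\mathrm{grad} f_i(x_0^s)$; for $t=0,\dots,m-1$ draw $b$ independent uniform indices $\mathcal I_t^s$, put $$v_t^s=\mathrm{grad} f_{\mathcal I_t^s}(x_t^s)-\mathcal T_{x_0^s}^{x_t^s}\big(\mathrm{grad} f_{\mathcal I_t^s}(x_0^s)-v_0^s\big),\qquad x_{t+1}^s=R_{x_t^s}(-\eta v_t^s),$$ where $\mathrm{grad} f_{\mathcal I}$ is the average of $\mathrm{grad} f_i$ over the $b$ drawn indices; then $\tilde x^s=x_m^s$. The output $\tilde x$ is uniform on $\{x_t^s:1\le s\le S,\ 0\le t<m\}$. Each evaluation of some $\mathrm{grad} f_i$ at a point costs one IFO call. The iterates are assumed to stay continuously in $\mathcal X$: for all realizations, $R_{x_t^s}(-\tau\eta v_t^s)\in\mathcal X$ for all $s$, all $t<m$ and $\tau\in[0,1]$ (in the complexity statements: for every number of epochs $S$). Let $\Delta=f(\tilde x^0)-f(x^*)$ and, for a numerical constant $\varrho_1>0$, $\Theta_1=L+\sqrt{L^2+\varrho_1(L_l+\theta G)^2\mu^2\nu^2}$. **Claim (convergence).** If $0<\eta\le\dfrac{2}{L+\sqrt{L^2+4(L_l+\theta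 G)^2\mu^2\nu^2m^2/b}}$, then after $T=Sm$ iterations $$\mathbb E\|\mathrm{grad} f(\tilde x)\|^2\le\frac{2\Delta}{T\eta}+\mathbf 1_{\{B<n\}}\frac{\sigma^2}{B}.$$ **Claim (IFO complexity).** For every $\varrho_1>0$ there is a constant $C>0$ depending on $\varrho_1$ only such that the following holds for every problem as above and every $\varepsilon>0$. Let $b=m^2$ and $\eta=2/\big(L+\sqrt{L^2+4(L_l+\theta G)^2\mu^2\nu^2}\big)$. - *Finite-sum setting.* With $B=n$ and $m=\lfloor n^{1/3}\rfloor$ there is a number of epochs $S\ge1$ for which $\mathbb E\|\mathrm{grad} f(\tilde x)\|\le\varepsilon$ and the total number of IFO calls is at most $C\big(n+\Delta\,\Theta_1n^{2/3}/\varepsilon^2\big)$. - *Online setting* (bounds independent of $n$). Let $\varepsilon\le\sigma$, $B=\lceil2\sigma^2/\varepsilon^2\rceil\le n$ and $m=\lfloor(\sigma/\varepsilon)^{2/3}\rfloor$. There is $S\ge1$ for which $\mathbb E\|\mathrm{grad} f(\tilde x)\|\le\varepsilon$ and the total number of IFO calls is at most $C\big(\sigma^2/\varepsilon^2+\Delta\,\Theta_1\sigma^{4/3}/\varepsilon^{10/3}\big)$.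 If moreover $\varepsilon$ is so small that $\sigma^{2/3}\varepsilon^{4/3}\le\Theta_1$, this number is at most $C(1+\Delta)\,\Theta_1\sigma^{4/3}/\varepsilon^{10/3}$. -/

import Mathlib

open Bundle Manifold Set
open scoped ContDiff BigOperators

noncomputable section RiemannianSVRG

section Geometry

variable {E : Type*} [NormedAddCommGroup E] [NormedSpace ℝ E] [FiniteDimensional ℝ E]
  {M : Type*} [TopologicalSpace M] [ChartedSpace E M] [IsManifold 𝓘(ℝ, E) ∞ M]
  [RiemannianBundle (fun x : M => TangentSpace 𝓘(ℝ, E) x)]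

instance tangentSpaceFiniteDimensional (x : M) :
    FiniteDimensional ℝ (TangentSpace 𝓘(ℝ, E) x) :=
  inferInstanceAs (FiniteDimensional ℝ E)

instance tangentSpaceComplete (x : M) : CompleteSpace (TangentSpace 𝓘(ℝ, E) x) :=
  FiniteDimensional.complete ℝ _

/-- Riemannian gradient: the tangent vector at `x` representing the differential of `f` at `x`
for the Riemannian inner product of `T_x M`. -/
def rgrad (f : M → ℝ) (x : M) : TangentSpace 𝓘(ℝ, E) x :=
  (InnerProductSpace.toDual ℝ (TangentSpace 𝓘(ℝ, E) x)).symm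
    (mfderiv 𝓘(ℝ, E) 𝓘(ℝ, ℝ) f x)

/-- The metric tensor `g_y(u, v)` in the preferred chart at `p`, at the point of coordinates `y`. -/
def chartMetric (p : M) (y u v : E) : ℝ :=
  inner ℝ
    (mfderiv 𝓘(ℝ, E) 𝓘(ℝ, E) (extChartAt 𝓘(ℝ, E) p).symm y u :
      TangentSpace 𝓘(ℝ, E) ((extChartAt 𝓘(ℝ, E) p).symm y))
    (mfderiv 𝓘(ℝ, E) 𝓘(ℝ, E) (extChartAt 𝓘(ℝ, E) p).symm y v)

/-- Derivative at `y`, in the direction `w`, of the metric coefficient `g(u, v)` in the chart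
at `p`. -/
def chartMetricDeriv (p : M) (y w u v : E) : ℝ :=
  fderiv ℝ (fun z => chartMetric p z u v) y w

/-- Christoffel symbol of the first kind of the Levi-Civita connection in the chart at `p`:
`g(Γ(u, v), w) = (∂_u g(v, w) + ∂_v g(u, w) - ∂_w g(u, v)) / 2`. -/
def christoffelFirst (p : M) (y u v w : E) : ℝ :=
  (chartMetricDeriv p y u v w + chartMetricDeriv p y v u w - chartMetricDeriv p y w u v) / 2

/-- The vector field `V` along the curve `c`, `0 ≤ t ≤ 1`, is parallel for the Levi-Civita
connection. At every `t`, in the chart at `c t`, the covariant derivative `V' + Γ(c', V)` is zero;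
this is tested against every `w` with the metric, so that only symbols of the first kind occur. -/
def IsParallelAlong (c : ℝ → M) (V : ∀ t, TangentSpace 𝓘(ℝ, E) (c t)) : Prop :=
  ∀ t ∈ Icc (0 : ℝ) 1, ∃ c' V' : E,
    HasDerivWithinAt (fun s => (extChartAt 𝓘(ℝ, E) (c t) (c s) : E)) c' (Icc 0 1) t ∧
    HasDerivWithinAt
      (fun s => (mfderiv 𝓘(ℝ, E) 𝓘(ℝ, E) (extChartAt 𝓘(ℝ, E) (c t)) (c s) (V s) : E))
      V' (Icc 0 1) t ∧
    ∀ w : E,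
      chartMetric (c t) (extChartAt 𝓘(ℝ, E) (c t) (c t)) V' w +
        christoffelFirst (c t) (extChartAt 𝓘(ℝ, E) (c t) (c t)) c'
          (mfderiv 𝓘(ℝ, E) 𝓘(ℝ, E) (extChartAt 𝓘(ℝ, E) (c t)) (c t) (V t) : E) w = 0

theorem nonempty_tangent_isometry (x y : M) :
    Nonempty (TangentSpace 𝓘(ℝ, E) x ≃ₗᵢ[ℝ] TangentSpace 𝓘(ℝ, E) y) := by
  have h : Module.finrank ℝ (TangentSpace 𝓘(ℝ, E) x)
      = Module.finrank ℝ (TangentSpace 𝓘(ℝ, E) y) := rfl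
  exact ⟨(stdOrthonormalBasis ℝ _).repr.trans
    (((stdOrthonormalBasis ℝ (TangentSpace 𝓘(ℝ, E) y)).reindex (finCongr h.symm)).repr.symm)⟩

/-- Parallel transport along `c` from `c 0` to `c 1`: the linear isometry that sends `V 0` to `V 1`
for the parallel fields `V` along `c`. (Along a `C^1` curve there is exactly one parallel field for
each initial value and its inner products are constant, so exactly one isometry qualifies.)
The transport back from `c 1` to `c 0` is its inverse. -/
def parallelTransport (c : ℝ → M) :
    TangentSpace 𝓘(ℝ, E) (c 0) ≃ₗᵢ[ℝ] TangentSpace 𝓘(ℝ, E) (c 1) :=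
  haveI := nonempty_tangent_isometry (E := E) (c 0) (c 1)
  Classical.epsilon fun P : TangentSpace 𝓘(ℝ, E) (c 0) ≃ₗᵢ[ℝ] TangentSpace 𝓘(ℝ, E) (c 1) =>
    ∀ v, ∃ V : ∀ t, TangentSpace 𝓘(ℝ, E) (c t), IsParallelAlong c V ∧ V 0 = v ∧ V 1 = P v

variable (E M) in
/-- A retraction: a smooth map `R : TM → M` with `R_x(0) = x` and `D R_x(0) = id`. -/
structure Retraction where
  toFun : ∀ x : M, TangentSpace 𝓘(ℝ, E) x → M
  smooth : ContMDiff (𝓘(ℝ, E).tangent) 𝓘(ℝ, E) ∞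
    (fun v : TangentBundle 𝓘(ℝ, E) M => toFun v.proj v.snd)
  map_zero : ∀ x, toFun x 0 = x
  deriv_zero : ∀ (x : M) (ξ : TangentSpace 𝓘(ℝ, E) x),
    (mfderiv 𝓘(ℝ, TangentSpace 𝓘(ℝ, E) x) 𝓘(ℝ, E) (toFun x) 0 ξ : E) = (ξ : E)

/-- The retraction curve `t ↦ R_x(t ξ)`. -/
def Retraction.curve (R : Retraction E M) (x : M) (ξ : TangentSpace 𝓘(ℝ, E) x) : ℝ → M :=
  fun t => R.toFun x (t • ξ)

/-- An isometric vector transport `𝒯_ξ : T_x M → T_{R_x(ξ)} M` associated with `R`. All tangent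
spaces are copies of `E`, hence `map_zero` may be written as an equality in `E`. -/
structure VectorTransport (R : Retraction E M) where
  toFun : ∀ (x : M) (ξ : TangentSpace 𝓘(ℝ, E) x),
    TangentSpace 𝓘(ℝ, E) x →ₗᵢ[ℝ] TangentSpace 𝓘(ℝ, E) (R.toFun x ξ)
  map_zero : ∀ (x : M) (v : TangentSpace 𝓘(ℝ, E) x), (toFun x 0 v : E) = (v : E)

/-- Parallel transport `P_x^y : T_x M → T_y M`, `y = R_x(ξ)`, along the retraction curve
`t ↦ R_x(t ξ)`; its inverse is `P_y^x`. The curve starts at `R_x(0 • ξ) = x` and ends at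
`R_x(1 • ξ) = R_x(ξ)`, and the tangent spaces at equal points are the same copy of `E`. -/
def Retraction.parallel (R : Retraction E M) (x : M) (ξ : TangentSpace 𝓘(ℝ, E) x) :
    TangentSpace 𝓘(ℝ, E) x ≃ₗᵢ[ℝ] TangentSpace 𝓘(ℝ, E) (R.toFun x ξ) :=
  have h0 : R.curve x ξ 0 = x := by simp [Retraction.curve, R.map_zero]
  have h1 : R.curve x ξ 1 = R.toFun x ξ := by simp [Retraction.curve]
  cast (by rw [h0, h1]) (parallelTransport (E := E) (R.curve x ξ))

end Geometry

section Setting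

variable {E : Type*} [NormedAddCommGroup E] [NormedSpace ℝ E] [FiniteDimensional ℝ E]
  {M : Type*} [EMetricSpace M] [ChartedSpace E M] [IsManifold 𝓘(ℝ, E) ∞ M]
  [RiemannianBundle (fun x : M => TangentSpace 𝓘(ℝ, E) x)] {n : ℕ}

variable (E M n) in
/-- The data of the optimization problem: components `f_1, …, f_n`, retraction, vector transport,
the set `X` with the point `xstar`, the radius `ρ` of the balls on which the retraction is
inverted, and the constants of the assumptions. -/
structure SVRGProblem where
  f : Fin n → M → ℝ
  R : Retraction E M
  T : VectorTransport R
  X : Set M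
  xstar : M
  ρ : ℝ
  L : ℝ
  Ll : ℝ
  G : ℝ
  σ : ℝ
  θ : ℝ
  μ : ℝ
  ν : ℝ

namespace SVRGProblem

/-- The objective `f = (1/n) ∑ f_i`. -/
def obj (p : SVRGProblem E M n) (x : M) : ℝ := (1 / (n : ℝ)) * ∑ i, p.f i x

/-- The inverse retraction `R_x⁻¹(y)`: the preimage of `y` in the ball of radius `ρ` of `T_x M`. -/
def invRetr (p : SVRGProblem E M n) (x y : M) : TangentSpace 𝓘(ℝ, E) x :=
  Function.invFunOn (p.R.toFun x) (Metric.ball (0 : TangentSpace 𝓘(ℝ, E) x) p.ρ) y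

/-- The vector transport `𝒯_x^y = 𝒯_ξ` with `ξ = R_x⁻¹(y)`. As `R_x(ξ) = y`, its values lie in
`T_y M` (tangent spaces at equal points are the same copy of `E`). -/
def transport (p : SVRGProblem E M n) (x y : M) (v : TangentSpace 𝓘(ℝ, E) x) :
    TangentSpace 𝓘(ℝ, E) y :=
  (p.T.toFun x (p.invRetr x y) v : E)

/-- The standing assumptions. A pair `x, y = R_x(ξ)` in `X` is always taken with `‖ξ‖ < ρ`, that
is `ξ = R_x⁻¹(y)`. -/
structure Assumptions (p : SVRGProblem E M n) : Prop where
  rho_pos : 0 < p.ρ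
  L_pos : 0 < p.L
  Ll_pos : 0 < p.Ll
  G_pos : 0 < p.G
  sigma_nonneg : 0 ≤ p.σ
  theta_pos : 0 < p.θ
  mu_pos : 0 < p.μ
  nu_pos : 0 < p.ν
  /-- the components are twice continuously differentiable -/
  smooth : ∀ i, ContMDiff 𝓘(ℝ, E) 𝓘(ℝ, ℝ) 2 (p.f i)
  /-- `X` is a neighbourhood of `xstar`, which is optimal within `X` -/
  nhds : p.X ∈ nhds p.xstar
  optimal : ∀ x ∈ p.X, p.obj p.xstar ≤ p.obj x
  /-- `X` is totally retractive: for every `x ∈ X`, the map `R_x` is a diffeomorphism of the ball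
  of radius `ρ` onto an open set that contains `X` -/
  retr_injOn : ∀ x ∈ p.X,
    InjOn (p.R.toFun x) (Metric.ball (0 : TangentSpace 𝓘(ℝ, E) x) p.ρ)
  retr_diffeo : ∀ x ∈ p.X,
    IsLocalDiffeomorphOn 𝓘(ℝ, TangentSpace 𝓘(ℝ, E) x) 𝓘(ℝ, E) ∞ (p.R.toFun x)
      (Metric.ball (0 : TangentSpace 𝓘(ℝ, E) x) p.ρ)
  retr_covers : ∀ x ∈ p.X,
    p.X ⊆ p.R.toFun x '' Metric.ball (0 : TangentSpace 𝓘(ℝ, E) x) p.ρ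
  /-- bounded component gradients -/
  grad_bound : ∀ x ∈ p.X, ∀ i, ‖(rgrad (p.f i) x : TangentSpace 𝓘(ℝ, E) x)‖ ≤ p.G
  /-- bounded variance -/
  variance_bound : ∀ x ∈ p.X,
    (1 / (n : ℝ)) * ∑ i, ‖(rgrad (p.f i) x - rgrad p.obj x : TangentSpace 𝓘(ℝ, E) x)‖ ^ 2
      ≤ p.σ ^ 2
  /-- retraction `L`-smoothness of the objective -/
  retr_smooth : ∀ x ∈ p.X, ∀ ξ : TangentSpace 𝓘(ℝ, E) x, ‖ξ‖ < p.ρ → p.R.toFun x ξ ∈ p.X →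
    p.obj (p.R.toFun x ξ) ≤ p.obj x + inner ℝ (rgrad p.obj x) ξ + p.L / 2 * ‖ξ‖ ^ 2
  /-- average (mean-square) retraction `L_l`-Lipschitz gradients -/
  retr_lipschitz : ∀ x ∈ p.X, ∀ ξ : TangentSpace 𝓘(ℝ, E) x, ‖ξ‖ < p.ρ → p.R.toFun x ξ ∈ p.X →
    (1 / (n : ℝ)) * ∑ i, ‖(rgrad (p.f i) x : TangentSpace 𝓘(ℝ, E) x)
      - (p.R.parallel x ξ).symm (rgrad (p.f i) (p.R.toFun x ξ))‖ ^ 2 ≤ (p.Ll * ‖ξ‖) ^ 2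
  /-- vector transport is close to parallel transport along the retraction curve -/
  transport_close : ∀ x ∈ p.X, ∀ ξ : TangentSpace 𝓘(ℝ, E) x, ‖ξ‖ < p.ρ → p.R.toFun x ξ ∈ p.X →
    ∀ v : TangentSpace 𝓘(ℝ, E) x,
      ‖p.T.toFun x ξ v - p.R.parallel x ξ v‖ ≤ p.θ * ‖ξ‖ * ‖v‖
  /-- `‖ξ‖ ≤ μ d(x, y)` and `d(x, y) ≤ ν ‖ξ‖`, for the Riemannian distance `d` -/
  norm_le_dist : ∀ x ∈ p.X, ∀ ξ : TangentSpace 𝓘(ℝ, E) x, ‖ξ‖ < p.ρ → p.R.toFun x ξ ∈ p.X →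
    ENNReal.ofReal ‖ξ‖ ≤ ENNReal.ofReal p.μ * edist x (p.R.toFun x ξ)
  dist_le_norm : ∀ x ∈ p.X, ∀ ξ : TangentSpace 𝓘(ℝ, E) x, ‖ξ‖ < p.ρ → p.R.toFun x ξ ∈ p.X →
    edist x (p.R.toFun x ξ) ≤ ENNReal.ofReal (p.ν * ‖ξ‖)

end SVRGProblem

end Setting

section Algorithm

/-- A value together with the number of oracle calls spent on it. -/
structure Counted (α : Type*) where
  val : α
  calls : ℕ

/-- The random choices of one epoch: the batch, a `B`-element subset of the `n` indices (sampling
without replacement), and `m` mini-batches of `b` independent indices (with replacement). -/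
abbrev EpochSample (n B m b : ℕ) : Type :=
  {s : Finset (Fin n) // s.card = B} × (Fin m → Fin b → Fin n)

/-- The random choices of a run with `S` epochs. The uniform law on this finite set makes all
choices uniform and independent. -/
abbrev RunSample (n B m b S : ℕ) : Type := Fin S → EpochSample n B m b

variable {E : Type*} [NormedAddCommGroup E] [NormedSpace ℝ E] [FiniteDimensional ℝ E]
  {M : Type*} [EMetricSpace M] [ChartedSpace E M] [IsManifold 𝓘(ℝ, E) ∞ M]
  [RiemannianBundle (fun x : M => TangentSpace 𝓘(ℝ, E) x)] {n B m b S : ℕ}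

namespace SVRGProblem

/-- The incremental first-order oracle: `grad f_i(x)`, at the price of one call. -/
def ifo (p : SVRGProblem E M n) (i : Fin n) (x : M) : Counted (TangentSpace 𝓘(ℝ, E) x) :=
  ⟨rgrad (p.f i) x, 1⟩

/-- The mini-batch gradient at `x` over a finite family of indices. -/
def batchGrad (p : SVRGProblem E M n) {ι : Type} [Fintype ι] (idx : ι → Fin n) (x : M) :
    Counted (TangentSpace 𝓘(ℝ, E) x) :=
  ⟨(1 / (Fintype.card ι : ℝ)) • ∑ j, (p.ifo (idx j) x).val, ∑ j, (p.ifo (idx j) x).calls⟩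

/-- The modified gradient
`v = grad f_I(x) - 𝒯_{x0}^x (grad f_I(x0) - v0)`, with reference point `x0`. -/
def direction (p : SVRGProblem E M n) (x0 : M) (v0 : TangentSpace 𝓘(ℝ, E) x0)
    (I : Fin b → Fin n) (x : M) : Counted (TangentSpace 𝓘(ℝ, E) x) :=
  let g := p.batchGrad I x
  let g0 := p.batchGrad I x0
  ⟨g.val - p.transport x0 x (g0.val - v0), g.calls + g0.calls⟩

/-- The inner loop after `t ≤ m` steps `x_{t+1} = R_{x_t}(-η v_t)`. -/
def innerLoop (p : SVRGProblem E M n) (η : ℝ) (x0 : M) (v0 : TangentSpace 𝓘(ℝ, E) x0)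
    (I : Fin m → Fin b → Fin n) : ℕ → Counted M
  | 0 => ⟨x0, 0⟩
  | t + 1 =>
    let c := p.innerLoop η x0 v0 I t
    if h : t < m then
      let v := p.direction x0 v0 (I ⟨t, h⟩) c.val
      ⟨p.R.toFun c.val (-(η • v.val)), c.calls + v.calls⟩
    else c

/-- The batch gradient `v_0` at the start of an epoch. -/
def epochGrad (p : SVRGProblem E M n) (w : EpochSample n B m b) (x0 : M) :
    Counted (TangentSpace 𝓘(ℝ, E) x0) :=
  p.batchGrad (fun i : w.1.1 => i.1) x0

/-- The outer loop after `s ≤ S` epochs, with the number of oracle calls made so far. -/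
def outerLoop (p : SVRGProblem E M n) (η : ℝ) (xinit : M) (w : RunSample n B m b S) :
    ℕ → Counted M
  | 0 => ⟨xinit, 0⟩
  | s + 1 =>
    let c := p.outerLoop η xinit w s
    if h : s < S then
      let v0 := p.epochGrad (w ⟨s, h⟩) c.val
      let l := p.innerLoop η c.val v0.val (w ⟨s, h⟩).2 m
      ⟨l.val, c.calls + v0.calls + l.calls⟩
    else c

/-- The reference point `x_0^s` of epoch `s`. -/
def refPoint (p : SVRGProblem E M n) (η : ℝ) (xinit : M) (w : RunSample n B m b S)
    (s : Fin S) : M :=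
  (p.outerLoop η xinit w s).val

/-- The iterate `x_t^s`. -/
def iterate (p : SVRGProblem E M n) (η : ℝ) (xinit : M) (w : RunSample n B m b S)
    (s : Fin S) (t : Fin m) : M :=
  (p.innerLoop η (p.refPoint η xinit w s)
    (p.epochGrad (w s) (p.refPoint η xinit w s)).val (w s).2 t).val

/-- The modified gradient `v_t^s`, a tangent vector at `x_t^s`. -/
def stepGrad (p : SVRGProblem E M n) (η : ℝ) (xinit : M) (w : RunSample n B m b S)
    (s : Fin S) (t : Fin m) : TangentSpace 𝓘(ℝ, E) (p.iterate η xinit w s t) :=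
  (p.direction (p.refPoint η xinit w s)
    (p.epochGrad (w s) (p.refPoint η xinit w s)).val ((w s).2 t)
    (p.iterate η xinit w s t)).val

/-- Total number of oracle calls of the run. -/
def totalCalls (p : SVRGProblem E M n) (η : ℝ) (xinit : M) (w : RunSample n B m b S) : ℕ :=
  (p.outerLoop η xinit w S).calls

variable (B m b S) in
/-- The iterates of the run with `S` epochs stay continuously in `X`: whatever the random choices,
all retraction curves `τ ↦ R_{x_t^s}(-τ η v_t^s)`, `0 ≤ τ ≤ 1`, remain in `X`. -/
def StaysIn (p : SVRGProblem E M n) (η : ℝ) (xinit : M) : Prop :=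
  xinit ∈ p.X ∧ ∀ (w : RunSample n B m b S) (s : Fin S) (t : Fin m), ∀ τ ∈ Icc (0 : ℝ) 1,
    p.R.toFun (p.iterate η xinit w s t) (-((τ * η) • p.stepGrad η xinit w s t)) ∈ p.X

variable (B m b S) in
/-- `𝔼 ‖grad f(x̃)‖ ^ k`, where `x̃` is uniform among the iterates `x_t^s`, `s < S`, `t < m`,
and the expectation is over all random choices of the run and of the output. -/
def expGradNormPow (p : SVRGProblem E M n) (η : ℝ) (xinit : M) (k : ℕ) : ℝ :=
  Finset.expect (Finset.univ : Finset (RunSample n B m b S × (Fin S × Fin m)))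
    fun q => ‖(rgrad p.obj (p.iterate η xinit q.1 q.2.1 q.2.2) :
      TangentSpace 𝓘(ℝ, E) (p.iterate η xinit q.1 q.2.1 q.2.2))‖ ^ k

/-- `Δ = f(x̃⁰) - f(x*)`. -/
def gap (p : SVRGProblem E M n) (xinit : M) : ℝ := p.obj xinit - p.obj p.xstar

/-- `L + √(L² + c (L_l + θ G)² μ² ν²)`. -/
def Theta (p : SVRGProblem E M n) (c : ℝ) : ℝ :=
  p.L + √(p.L ^ 2 + c * ((p.Ll + p.θ * p.G) ^ 2 * p.μ ^ 2 * p.ν ^ 2))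

end SVRGProblem

end Algorithm

end RiemannianSVRG

/-! Write `g_t` for the gradient of the objective at `x_t`. Retraction smoothness and polarization
give the descent step `f(x_{t+1}) ≤ f(x_t) - η/2 ‖g_t‖² - η/2 (1 - Lη) ‖v_t‖² + η/2 ‖v_t - g_t‖²`
(`EpochStays.descent`). Given the past, `v_t - g_t` is a centred mini-batch fluctuation plus the
isometric image of `v_0 - g_0`. Its mean square is therefore at most `(L_l + θG)²/b ·
‖R_{x_0}⁻¹(x_t)‖² + ‖v_0 - g_0‖²`, and the batch error does not accumulate
(`Assumptions.expect_norm_sq_direction_sub_le`).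

The drift `‖R_{x_0}⁻¹(x_t)‖` is at most `μ d(x_0, x_t)`, and the triangle inequality for `d` bounds
this by `μνη ∑ ‖v_k‖`. No curvature or compactness enters. By Cauchy-Schwarz the squared drifts of
an epoch sum to at most `μ²ν²η²m² ∑ ‖v_t‖²`. The step size is exactly such that `-η/2 (1 - Lη) ∑
‖v_t‖²` absorbs this term, pathwise (`EpochStays.sum_sq_grad_le`). What remains telescopes, up to
the sampling variance of the batch.

All randomness is uniform on finite product sets, so conditioning on the past amounts to resampling
one coordinate (`expect_eq_expect_expect_update`).

For the complexity, `b = m²` makes the step size independent of `m`, and an epoch costs `B + 2m³`.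
With `m = ⌊y⌋` and `B` of order `y³`, about `1 + ΔΘ/(mδ)` epochs reach mean-square accuracy `δ`, at
a cost of order `y³ + ΔΘy²/δ`. -/

section FiniteProbability

/-! ### Second moments of uniform samples, with and without replacement. -/

/-- Resampling one coordinate of a uniform random function does not change an expectation. -/
theorem expect_eq_expect_expect_update {ι α : Type*} [Fintype ι] [DecidableEq ι] [Fintype α]
    [Nonempty α] (F : (ι → α) → ℝ) (i : ι) :
    Finset.expect Finset.univ F =
      Finset.expect Finset.univ fun w : ι → α =>
        Finset.expect Finset.univ fun a : α => F (Function.update w i a) := by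
  -- Exchanging `w i` with an independent uniform value is an involution, so it preserves the
  -- uniform law of the pair.
  let e : (ι → α) × α ≃ (ι → α) × α :=
    Function.Involutive.toPerm (fun q => (Function.update q.1 i q.2, q.1 i)) (by
      rintro ⟨w, a⟩; simp)
  have h1 : (Finset.expect Finset.univ fun w : ι → α =>
        Finset.expect Finset.univ fun a : α => F (Function.update w i a)) =
      Finset.expect Finset.univ fun q : (ι → α) × α => F (Function.update q.1 i q.2) := by
    rw [← Finset.univ_product_univ, Finset.expect_product]
  have h2 : (Finset.expect Finset.univ fun q : (ι → α) × α => F (Function.update q.1 i q.2)) =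
      Finset.expect Finset.univ fun q : (ι → α) × α => F q.1 :=
    Fintype.expect_equiv e _ _ fun q => rfl
  rw [h1, h2, ← Finset.univ_product_univ, Finset.expect_product]
  simp

variable {V : Type*} [NormedAddCommGroup V] [InnerProductSpace ℝ V]

theorem norm_sum_sq {ι : Type*} (s : Finset ι) (h : ι → V) :
    ‖∑ j ∈ s, h j‖ ^ 2 = ∑ j ∈ s, ∑ k ∈ s, inner ℝ (h j) (h k) := by
  rw [← real_inner_self_eq_norm_sq, sum_inner]
  simp_rw [inner_sum]

theorem expect_inner_eq_zero {n b : ℕ} [NeZero n] {h : Fin n → V} (h0 : ∑ i, h i = 0)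
    {j k : Fin b} (hjk : j ≠ k) :
    (Finset.expect Finset.univ fun I : Fin b → Fin n => (inner ℝ (h (I j)) (h (I k)) : ℝ)) = 0 := by
  classical
  rw [expect_eq_expect_expect_update _ j]
  refine Finset.expect_eq_zero fun w _ => ?_
  rw [Fintype.expect_eq_sum_div_card]
  simp only [Function.update_self, Function.update_of_ne hjk.symm]
  rw [← sum_inner, h0, inner_zero_left, zero_div]

/-- Variance of the mean of `b` independent uniform samples of a centred family. -/
theorem expect_norm_sq_miniBatch {n b : ℕ} [NeZero n] (hb : 1 ≤ b) {h : Fin n → V}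
    (h0 : ∑ i, h i = 0) :
    (Finset.expect Finset.univ fun I : Fin b → Fin n => ‖(1 / (b : ℝ)) • ∑ j, h (I j)‖ ^ 2) =
      1 / (b : ℝ) * (1 / (n : ℝ) * ∑ i, ‖h i‖ ^ 2) := by
  classical
  have hb' : (b : ℝ) ≠ 0 := by positivity
  have key (j k : Fin b) : (Finset.expect Finset.univ fun I : Fin b → Fin n =>
      (inner ℝ (h (I j)) (h (I k)) : ℝ)) =
      if j = k then 1 / (n : ℝ) * ∑ i, ‖h i‖ ^ 2 else 0 := by
    split_ifs with hjk
    · subst hjk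
      rw [expect_eq_expect_expect_update _ j]
      simp only [Function.update_self, real_inner_self_eq_norm_sq]
      rw [Fintype.expect_const, Fintype.expect_eq_sum_div_card, Fintype.card_fin]
      ring
    · exact expect_inner_eq_zero h0 hjk
  simp_rw [norm_smul, mul_pow, norm_sum_sq]
  rw [← Finset.mul_expect]
  simp_rw [Finset.expect_sum_comm, key]
  simp only [Finset.sum_ite_eq, Finset.mem_univ, if_true, Finset.sum_const, Finset.card_univ,
    Fintype.card_fin, nsmul_eq_mul, norm_div, norm_one, RCLike.norm_natCast]
  field_simp

/-- Resampling a single index kills its inner product with the fixed vector `u`. The result is an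
equality, so no factor 2 is lost when the batch error is added to the mini-batch variance. -/
theorem expect_norm_sq_miniBatch_add {n b : ℕ} [NeZero n] (hb : 1 ≤ b) {h : Fin n → V}
    (h0 : ∑ i, h i = 0) (u : V) :
    (Finset.expect Finset.univ fun I : Fin b → Fin n => ‖(1 / (b : ℝ)) • ∑ j, h (I j) + u‖ ^ 2) =
      1 / (b : ℝ) * (1 / (n : ℝ) * ∑ i, ‖h i‖ ^ 2) + ‖u‖ ^ 2 := by
  classical
  have hcross (j : Fin b) :
      (Finset.expect Finset.univ fun I : Fin b → Fin n => (inner ℝ (h (I j)) u : ℝ)) = 0 := by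
    rw [expect_eq_expect_expect_update _ j]
    refine Finset.expect_eq_zero fun w _ => ?_
    rw [Fintype.expect_eq_sum_div_card]
    simp only [Function.update_self]
    rw [← sum_inner, h0, inner_zero_left, zero_div]
  simp_rw [norm_add_sq_real, Finset.expect_add_distrib, expect_norm_sq_miniBatch hb h0,
    real_inner_smul_left, sum_inner, ← Finset.mul_expect, Finset.expect_sum_comm, hcross]
  simp

/-- The variance is at most the second moment. -/
theorem mean_norm_sq_sub_mean_le {n : ℕ} (hn : 1 ≤ n) (a : Fin n → V) :
    1 / (n : ℝ) * ∑ i, ‖a i - (1 / (n : ℝ)) • ∑ k, a k‖ ^ 2 ≤ 1 / (n : ℝ) * ∑ i, ‖a i‖ ^ 2 := by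
  have hn' : (n : ℝ) ≠ 0 := by positivity
  set c := (1 / (n : ℝ)) • ∑ k, a k with hc
  have hs : ∑ k, a k = (n : ℝ) • c := by
    rw [hc, smul_smul, mul_one_div_cancel hn', one_smul]
  gcongr ?_ * ?_
  simp_rw [norm_sub_sq_real, Finset.sum_add_distrib, Finset.sum_sub_distrib, ← Finset.mul_sum,
    ← sum_inner, hs, real_inner_smul_left, real_inner_self_eq_norm_sq]
  simp only [Finset.sum_const, Finset.card_univ, Fintype.card_fin, nsmul_eq_mul]
  have : 0 ≤ (n : ℝ) * ‖c‖ ^ 2 := by positivity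
  linarith

theorem sum_sub_mean_eq_zero {n : ℕ} (hn : 1 ≤ n) (a : Fin n → V) :
    ∑ i, (a i - (1 / (n : ℝ)) • ∑ k, a k) = 0 := by
  have hn' : (n : ℝ) ≠ 0 := by positivity
  rw [Finset.sum_sub_distrib, Finset.sum_const, Finset.card_univ, Fintype.card_fin,
    ← Nat.cast_smul_eq_nsmul ℝ, smul_smul, mul_one_div_cancel hn', one_smul, sub_self]

/-- The case distinction is needed because `B - t.card` is truncated: for `t.card > B` the binomial
coefficient would be 1 instead of 0. -/
theorem sum_powersetCard_ite_subset {n : ℕ} (B : ℕ) (t : Finset (Fin n)) :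
    (∑ s ∈ Finset.powersetCard B (Finset.univ : Finset (Fin n)), if t ⊆ s then (1 : ℝ) else 0) =
      if t.card ≤ B then (((n - t.card).choose (B - t.card) : ℕ) : ℝ) else 0 := by
  rw [Finset.sum_boole]
  split_ifs with h
  · rw [Finset.card_filter_powersetCard_subset t _ B (Finset.subset_univ t) h, Finset.card_univ,
      Fintype.card_fin]
  · rw [Nat.cast_eq_zero, Finset.card_eq_zero, Finset.filter_eq_empty_iff]
    intro s hs hts
    rw [Finset.mem_powersetCard] at hs
    exact h (hs.2 ▸ Finset.card_le_card hts)

/-- The number of `B`-subsets containing both `i` and `k` takes only two values, `N 1` on the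
diagonal and `N 2` off it. Since the family sums to zero, the full double sum of inner products
vanishes and `(N 1 - N 2) ∑ ‖h i‖²` is left; the helpful term in `N 2` is then dropped. -/
theorem sum_norm_sq_powersetCard_le {n B : ℕ} (hB : 1 ≤ B) {h : Fin n → V} (h0 : ∑ i, h i = 0) :
    ∑ s ∈ Finset.powersetCard B (Finset.univ : Finset (Fin n)), ‖∑ i ∈ s, h i‖ ^ 2 ≤
      ((n - 1).choose (B - 1) : ℕ) * ∑ i, ‖h i‖ ^ 2 := by
  classical
  set N : ℕ → ℝ := fun c => if c ≤ B then (((n - c).choose (B - c) : ℕ) : ℝ) else 0 with hN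
  have hN0 : ∀ c, 0 ≤ N c := fun c => by simp only [hN]; split_ifs <;> positivity
  have hN1 : N 1 = ((n - 1).choose (B - 1) : ℕ) := by simp only [hN, if_pos hB]
  have h1 (s : Finset (Fin n)) : ‖∑ i ∈ s, h i‖ ^ 2 =
      ∑ i, ∑ k, (if {i, k} ⊆ s then (1 : ℝ) else 0) * inner ℝ (h i) (h k) := by
    have (f : Fin n → ℝ) : ∑ i ∈ s, f i = ∑ i, if i ∈ s then f i else 0 := by simp
    rw [norm_sum_sq, this]
    refine Finset.sum_congr rfl fun i _ => ?_
    rw [this]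
    by_cases hi : i ∈ s <;> simp [Finset.insert_subset_iff, hi]
  have h2 (i k : Fin n) : N (Finset.card {i, k}) * inner ℝ (h i) (h k) =
      (if i = k then (N 1 - N 2) * ‖h i‖ ^ 2 else 0) + N 2 * inner ℝ (h i) (h k) := by
    split_ifs with hik
    · subst hik
      simp only [Finset.pair_eq_singleton, Finset.card_singleton, real_inner_self_eq_norm_sq]; ring
    · rw [Finset.card_pair hik]; ring
  calc ∑ s ∈ Finset.powersetCard B (Finset.univ : Finset (Fin n)), ‖∑ i ∈ s, h i‖ ^ 2
      = ∑ i, ∑ k, N (Finset.card {i, k}) * inner ℝ (h i) (h k) := by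
        simp_rw [h1]
        rw [Finset.sum_comm]
        refine Finset.sum_congr rfl fun i _ => ?_
        rw [Finset.sum_comm]
        refine Finset.sum_congr rfl fun k _ => ?_
        rw [← Finset.sum_mul, sum_powersetCard_ite_subset]
    _ = (N 1 - N 2) * ∑ i, ‖h i‖ ^ 2 := by
        simp_rw [h2, Finset.sum_add_distrib, ← Finset.mul_sum, ← inner_sum, h0, inner_zero_right]
        simp [Finset.mul_sum]
    _ ≤ N 1 * ∑ i, ‖h i‖ ^ 2 := by
        gcongr
        linarith [hN0 2]
    _ = _ := by rw [hN1]

/-- Variance of the mean of a uniform `B`-element subset of a centred family. -/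
theorem expect_norm_sq_subset_le {n B : ℕ} (hB : 1 ≤ B) (hBn : B ≤ n) {h : Fin n → V}
    (h0 : ∑ i, h i = 0) {σ : ℝ} (hσ : 1 / (n : ℝ) * ∑ i, ‖h i‖ ^ 2 ≤ σ ^ 2) :
    (Finset.expect Finset.univ fun s : {s : Finset (Fin n) // s.card = B} =>
        ‖(1 / (B : ℝ)) • ∑ i ∈ s.1, h i‖ ^ 2) ≤ if B < n then σ ^ 2 / (B : ℝ) else 0 := by
  classical
  split_ifs with hlt
  · have hBpos : (0 : ℝ) < B := by positivity
    have hn1 : 1 ≤ n := hB.trans hBn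
    have hnpos : (0 : ℝ) < n := by positivity
    have hC : (0 : ℝ) < (n.choose B : ℕ) := by exact_mod_cast Nat.choose_pos hBn
    have hcard : Fintype.card {s : Finset (Fin n) // s.card = B} = n.choose B := by
      rw [Fintype.card_finset_len, Fintype.card_fin]
    have hsum : (∑ s : {s : Finset (Fin n) // s.card = B}, ‖∑ i ∈ s.1, h i‖ ^ 2) =
        ∑ s ∈ Finset.powersetCard B (Finset.univ : Finset (Fin n)), ‖∑ i ∈ s, h i‖ ^ 2 :=
      (Finset.sum_subtype _ (fun s => by simp) (fun s => ‖∑ i ∈ s, h i‖ ^ 2)).symm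
    rw [Fintype.expect_eq_sum_div_card, hcard]
    simp_rw [norm_smul, mul_pow]
    rw [← Finset.mul_sum, hsum, div_le_iff₀ hC]
    -- Double counting of pairs (index, subset containing it): an index lies in a fraction `B/n` of
    -- the subsets.
    have hmul : (n : ℝ) * ((n - 1).choose (B - 1) : ℕ) = (n.choose B : ℕ) * (B : ℝ) := by
      have := Nat.add_one_mul_choose_eq (n - 1) (B - 1)
      rw [Nat.sub_add_cancel hn1, Nat.sub_add_cancel hB] at this
      exact_mod_cast this
    have hS : ∑ i, ‖h i‖ ^ 2 ≤ n * σ ^ 2 := by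
      rwa [one_div, inv_mul_le_iff₀ hnpos] at hσ
    calc ‖1 / (B : ℝ)‖ ^ 2 *
          ∑ s ∈ Finset.powersetCard B (Finset.univ : Finset (Fin n)), ‖∑ i ∈ s, h i‖ ^ 2
        ≤ ‖1 / (B : ℝ)‖ ^ 2 * (((n - 1).choose (B - 1) : ℕ) * (n * σ ^ 2)) := by
          gcongr
          exact (sum_norm_sq_powersetCard_le hB h0).trans (by gcongr)
      _ = ‖1 / (B : ℝ)‖ ^ 2 * ((n * ((n - 1).choose (B - 1) : ℕ)) * σ ^ 2) := by ring
      _ = σ ^ 2 / B * (n.choose B : ℕ) := by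
          rw [hmul, norm_div, norm_one, RCLike.norm_natCast]
          field_simp
  -- The only subset of full size is everything, and the centred family sums to zero over it.
  · have hBn' : B = n := by omega
    refine le_of_eq (Finset.expect_eq_zero fun s _ => ?_)
    have : s.1 = Finset.univ := by
      rw [← Finset.card_eq_iff_eq_univ, s.2, hBn', Fintype.card_fin]
    rw [this, h0]
    simp

/-- Minkowski's inequality for the quadratic mean, with a constant second term. -/
theorem mean_sq_add_le {n : ℕ} (hn : 1 ≤ n) {a : Fin n → ℝ} {A c : ℝ}
    (hA : 0 ≤ A) (hc : 0 ≤ c) (h : 1 / (n : ℝ) * ∑ i, a i ^ 2 ≤ A ^ 2) :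
    1 / (n : ℝ) * ∑ i, (a i + c) ^ 2 ≤ (A + c) ^ 2 := by
  have hn' : (0 : ℝ) < n := by positivity
  have h1 : (1 / (n : ℝ) * ∑ i, a i) ^ 2 ≤ A ^ 2 := by
    refine le_trans ?_ h
    have := sq_sum_le_card_mul_sum_sq (s := (Finset.univ : Finset (Fin n))) (f := a)
    rw [Finset.card_univ, Fintype.card_fin] at this
    rw [mul_pow]
    calc (1 / (n : ℝ)) ^ 2 * (∑ i, a i) ^ 2 ≤ (1 / (n : ℝ)) ^ 2 * (n * ∑ i, a i ^ 2) := by gcongr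
      _ = _ := by field_simp
  have h2 : 1 / (n : ℝ) * ∑ i, a i ≤ A := abs_le_of_sq_le_sq' h1 hA |>.2
  have h3 : 1 / (n : ℝ) * ∑ i, (a i + c) ^ 2 =
      1 / (n : ℝ) * ∑ i, a i ^ 2 + 2 * c * (1 / (n : ℝ) * ∑ i, a i) + c ^ 2 := by
    simp_rw [add_sq, Finset.sum_add_distrib, ← Finset.sum_mul, ← Finset.mul_sum]
    simp
    field_simp
  rw [h3]
  nlinarith [mul_le_mul_of_nonneg_left h2 hc]

end FiniteProbability

/-! ### Gradients, inverse retraction and transport on `X`. -/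

section Geometry

variable {E : Type*} [NormedAddCommGroup E] [NormedSpace ℝ E] [FiniteDimensional ℝ E]
  {M : Type*} [EMetricSpace M] [ChartedSpace E M] [IsManifold 𝓘(ℝ, E) ∞ M]
  [RiemannianBundle (fun x : M => TangentSpace 𝓘(ℝ, E) x)] {n : ℕ}

namespace SVRGProblem

variable {p : SVRGProblem E M n}

theorem Assumptions.rgrad_obj (hp : p.Assumptions) (x : M) :
    (rgrad p.obj x : TangentSpace 𝓘(ℝ, E) x) = (1 / (n : ℝ)) • ∑ i, rgrad (p.f i) x := by
  have hd : ∀ i ∈ Finset.univ, HasMFDerivAt 𝓘(ℝ, E) 𝓘(ℝ, ℝ) (p.f i) x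
      (mfderiv 𝓘(ℝ, E) 𝓘(ℝ, ℝ) (p.f i) x) := fun i _ =>
    ((hp.smooth i).mdifferentiable (by norm_num) x).hasMFDerivAt
  have hobj : p.obj = (1 / (n : ℝ)) • ∑ i, p.f i := by
    funext y
    simp [obj]
  have h := (HasMFDerivAt.sum hd).const_smul (1 / (n : ℝ))
  rw [← hobj] at h
  have hlin (φ : Fin n → StrongDual ℝ (TangentSpace 𝓘(ℝ, E) x)) :
      (InnerProductSpace.toDual ℝ (TangentSpace 𝓘(ℝ, E) x)).symm ((1 / (n : ℝ)) • ∑ i, φ i) =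
        (1 / (n : ℝ)) • ∑ i, (InnerProductSpace.toDual ℝ (TangentSpace 𝓘(ℝ, E) x)).symm (φ i) := by
    rw [map_smul, map_sum]
  unfold rgrad
  rw [h.mfderiv]
  exact hlin fun i => mfderiv 𝓘(ℝ, E) 𝓘(ℝ, ℝ) (p.f i) x

theorem Assumptions.invRetr_mem (hp : p.Assumptions) {x y : M} (hx : x ∈ p.X) (hy : y ∈ p.X) :
    ‖p.invRetr x y‖ < p.ρ := by
  have := Function.invFunOn_mem (hp.retr_covers x hx hy)
  simpa [invRetr] using this

theorem Assumptions.retr_invRetr (hp : p.Assumptions) {x y : M} (hx : x ∈ p.X) (hy : y ∈ p.X) :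
    p.R.toFun x (p.invRetr x y) = y :=
  Function.invFunOn_eq (hp.retr_covers x hx hy)

omit [FiniteDimensional ℝ E] in
theorem _root_.Retraction.continuous_toFun (R : Retraction E M) (x : M) :
    Continuous (R.toFun x) :=
  R.smooth.continuous.comp (FiberBundle.continuous_totalSpaceMk E (TangentSpace 𝓘(ℝ, E) (M := M)) x)

/-- A tangent vector whose whole retraction curve stays in `X` has norm less than `ρ`. -/
theorem Assumptions.norm_lt_rho (hp : p.Assumptions) {x : M} {v : TangentSpace 𝓘(ℝ, E) x}
    (hv : ∀ τ ∈ Icc (0 : ℝ) 1, p.R.toFun x (τ • v) ∈ p.X) : ‖v‖ < p.ρ := by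
  have hx : x ∈ p.X := by
    simpa [p.R.map_zero] using hv 0 (by simp)
  by_contra! hρ
  have hvpos : 0 < ‖v‖ := hp.rho_pos.trans_le hρ
  -- The time at which the ray `τ • v` reaches the sphere of radius `ρ`. The curve point at that
  -- time is in `X`, so it also has a preimage `ξ` inside the open ball.
  set τ₀ : ℝ := p.ρ / ‖v‖ with hτ₀
  have hτ₀pos : 0 < τ₀ := div_pos hp.rho_pos hvpos
  have hτ₀le : τ₀ ≤ 1 := (div_le_one hvpos).2 hρ
  obtain ⟨ξ, hξ, hξeq⟩ := hp.retr_covers x hx (hv τ₀ ⟨hτ₀pos.le, hτ₀le⟩)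
  have hξρ : ‖ξ‖ < p.ρ := by simpa using hξ
  have hmap := (hp.retr_diffeo x hx).isLocalHomeomorphOn.map_nhds_eq hξ
  have hlim : Filter.Tendsto (fun τ : ℝ => τ • v) (nhdsWithin τ₀ (Iio τ₀)) (_root_.nhds (τ₀ • v)) :=
    (Continuous.tendsto (by fun_prop) τ₀).mono_left nhdsWithin_le_nhds
  have hcurve : Filter.Tendsto (fun τ : ℝ => p.R.toFun x (τ • v)) (nhdsWithin τ₀ (Iio τ₀))
      (_root_.nhds (p.R.toFun x ξ)) := by
    rw [hξeq]
    exact ((p.R.continuous_toFun x).tendsto _).comp hlim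
  -- Near `ξ` the retraction is open, so curve points just before `τ₀` have preimages close to `ξ`.
  -- Injectivity on the ball identifies these with `τ • v`; hence `ξ = τ₀ • v`, whose norm is `ρ`, a
  -- contradiction.
  have hlim' : Filter.Tendsto (fun τ : ℝ => τ • v) (nhdsWithin τ₀ (Iio τ₀)) (_root_.nhds ξ) := by
    refine Filter.tendsto_def.2 fun s hs => ?_
    have hs' : s ∩ Metric.ball 0 p.ρ ∈ _root_.nhds ξ :=
      Filter.inter_mem hs (Metric.isOpen_ball.mem_nhds hξ)
    have himg : p.R.toFun x '' (s ∩ Metric.ball 0 p.ρ) ∈ _root_.nhds (p.R.toFun x ξ) :=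
      hmap ▸ Filter.image_mem_map hs'
    have hIoo : Ioo 0 τ₀ ∈ nhdsWithin τ₀ (Iio τ₀) := Ioo_mem_nhdsLT hτ₀pos
    filter_upwards [hcurve himg, hIoo] with τ hτ hτ'
    obtain ⟨ζ, hζ, hζeq⟩ := hτ
    have hball : τ • v ∈ Metric.ball (0 : TangentSpace 𝓘(ℝ, E) x) p.ρ := by
      rw [mem_ball_zero_iff, norm_smul, Real.norm_of_nonneg hτ'.1.le]
      calc τ * ‖v‖ < τ₀ * ‖v‖ := by gcongr; exact hτ'.2
        _ = p.ρ := div_mul_cancel₀ _ hvpos.ne'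
    have := hp.retr_injOn x hx hζ.2 hball hζeq
    exact mem_preimage.2 (this ▸ hζ.1)
  have hξv : ξ = τ₀ • v := tendsto_nhds_unique hlim' hlim
  rw [hξv, norm_smul, Real.norm_of_nonneg hτ₀pos.le, hτ₀, div_mul_cancel₀ _ hvpos.ne'] at hξρ
  exact lt_irrefl _ hξρ

/-- Both transports are brought to the fiber over `y` itself. As `R_x(ξ) = y` is only a
propositional equality, the statement is generalized to an endpoint `z` and the equation is
substituted. -/
theorem Assumptions.exists_transport (hp : p.Assumptions) {x y : M} (hx : x ∈ p.X) (hy : y ∈ p.X) :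
    ∃ U P : TangentSpace 𝓘(ℝ, E) x →ₗᵢ[ℝ] TangentSpace 𝓘(ℝ, E) y,
      (∀ v, p.transport x y v = U v) ∧
      (∀ v, ‖U v - P v‖ ≤ p.θ * ‖p.invRetr x y‖ * ‖v‖) ∧
      (1 / (n : ℝ)) * ∑ i, ‖(rgrad (p.f i) y : TangentSpace 𝓘(ℝ, E) y) - P (rgrad (p.f i) x)‖ ^ 2
        ≤ (p.Ll * ‖p.invRetr x y‖) ^ 2 := by
  have hρ := hp.invRetr_mem hx hy
  have key : ∀ z (_ : p.R.toFun x (p.invRetr x y) = z) (_ : z ∈ p.X),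
      ∃ U P : TangentSpace 𝓘(ℝ, E) x →ₗᵢ[ℝ] TangentSpace 𝓘(ℝ, E) z,
      (∀ v, (p.T.toFun x (p.invRetr x y) v : E) = U v) ∧
      (∀ v, ‖U v - P v‖ ≤ p.θ * ‖p.invRetr x y‖ * ‖v‖) ∧
      (1 / (n : ℝ)) * ∑ i, ‖(rgrad (p.f i) z : TangentSpace 𝓘(ℝ, E) z) - P (rgrad (p.f i) x)‖ ^ 2
        ≤ (p.Ll * ‖p.invRetr x y‖) ^ 2 := by
    rintro z rfl hz
    refine ⟨p.T.toFun x (p.invRetr x y), (p.R.parallel x (p.invRetr x y)).toLinearIsometry,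
      fun v => rfl, fun v => hp.transport_close x hx _ hρ hz v, ?_⟩
    refine le_trans (le_of_eq ?_) (hp.retr_lipschitz x hx _ hρ hz)
    congr 1
    refine Finset.sum_congr rfl fun i _ => ?_
    congr 1
    -- The Lipschitz assumption compares gradients at `x`; applying the isometry moves the
    -- comparison to the endpoint.
    rw [← (p.R.parallel x (p.invRetr x y)).norm_map (_ - _), map_sub,
      LinearIsometryEquiv.apply_symm_apply, norm_sub_rev]
    rfl
  exact key y (hp.retr_invRetr hx hy) hy

/-- Mean-square error of transporting the component gradients from `x` to `y`. -/
theorem Assumptions.mean_sq_transport_le (hp : p.Assumptions) (hn : 1 ≤ n) {x y : M}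
    (hx : x ∈ p.X) (hy : y ∈ p.X) :
    (1 / (n : ℝ)) * ∑ i, ‖(rgrad (p.f i) y : TangentSpace 𝓘(ℝ, E) y)
      - p.transport x y (rgrad (p.f i) x)‖ ^ 2 ≤
      (p.Ll + p.θ * p.G) ^ 2 * ‖p.invRetr x y‖ ^ 2 := by
  obtain ⟨U, P, hU, hUP, hP⟩ := hp.exists_transport hx hy
  have hc : 0 ≤ p.θ * p.G * ‖p.invRetr x y‖ :=
    mul_nonneg (mul_nonneg hp.theta_pos.le hp.G_pos.le) (norm_nonneg _)
  have hA : 0 ≤ p.Ll * ‖p.invRetr x y‖ := mul_nonneg hp.Ll_pos.le (norm_nonneg _)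
  refine le_trans ?_ ((mean_sq_add_le hn hA hc hP).trans (le_of_eq (by ring)))
  gcongr with i
  rw [hU]
  -- Split into the Lipschitz error of parallel transport and the discrepancy of the two transports;
  -- the latter is proportional to the gradient norm, which `G` bounds.
  calc ‖(rgrad (p.f i) y : TangentSpace 𝓘(ℝ, E) y) - U (rgrad (p.f i) x)‖
      = ‖((rgrad (p.f i) y : TangentSpace 𝓘(ℝ, E) y) - P (rgrad (p.f i) x))
          - (U (rgrad (p.f i) x) - P (rgrad (p.f i) x))‖ := by congr 1; abel
    _ ≤ _ := norm_sub_le _ _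
    _ ≤ _ := by
      gcongr
      refine (hUP _).trans ?_
      have := mul_le_mul_of_nonneg_left (hp.grad_bound x hx i)
        (mul_nonneg hp.theta_pos.le (norm_nonneg (p.invRetr x y)))
      linarith

theorem Assumptions.transport_linear (hp : p.Assumptions) {x y : M}
    (hx : x ∈ p.X) (hy : y ∈ p.X) :
    ∃ U : TangentSpace 𝓘(ℝ, E) x →ₗᵢ[ℝ] TangentSpace 𝓘(ℝ, E) y,
      ∀ v, p.transport x y v = U v :=
  let ⟨U, _, hU, _⟩ := hp.exists_transport hx hy
  ⟨U, hU⟩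

end SVRGProblem

end Geometry

/-! ### Pathwise analysis of one epoch: drift and descent. -/

section Epoch

variable {E : Type*} [NormedAddCommGroup E] [NormedSpace ℝ E] [FiniteDimensional ℝ E]
  {M : Type*} [EMetricSpace M] [ChartedSpace E M] [IsManifold 𝓘(ℝ, E) ∞ M]
  [RiemannianBundle (fun x : M => TangentSpace 𝓘(ℝ, E) x)] {n B m b : ℕ}

namespace SVRGProblem

variable {p : SVRGProblem E M n}

/-- The iterate `x_t` of an epoch started at `x0` with random choices `e`. -/
noncomputable def epochIter (p : SVRGProblem E M n) (η : ℝ) (x0 : M) (e : EpochSample n B m b) (t : ℕ) : M :=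
  (p.innerLoop η x0 (p.epochGrad e x0).val e.2 t).val

/-- The modified gradient at `x_t` of an epoch started at `x0` with random choices `e`. -/
noncomputable def epochDir (p : SVRGProblem E M n) (η : ℝ) (x0 : M) (e : EpochSample n B m b) (t : Fin m) :
    TangentSpace 𝓘(ℝ, E) (p.epochIter η x0 e t) :=
  (p.direction x0 (p.epochGrad e x0).val (e.2 t) (p.epochIter η x0 e t)).val

variable (B m b) in
/-- The epoch started at `x0` stays continuously in `X` for all random choices. -/
def EpochStays (p : SVRGProblem E M n) (η : ℝ) (x0 : M) : Prop :=
  x0 ∈ p.X ∧ ∀ (e : EpochSample n B m b) (t : Fin m), ∀ τ ∈ Icc (0 : ℝ) 1,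
    p.R.toFun (p.epochIter η x0 e t) (-((τ * η) • p.epochDir η x0 e t)) ∈ p.X

theorem epochIter_succ (η : ℝ) (x0 : M) (e : EpochSample n B m b) (t : Fin m) :
    p.epochIter η x0 e (t + 1) =
      p.R.toFun (p.epochIter η x0 e t) (-(η • p.epochDir η x0 e t)) := by
  unfold epochIter
  rw [innerLoop]
  simp only [t.2, dif_pos]
  rfl

theorem EpochStays.iter_mem {η : ℝ} {x0 : M} (h : p.EpochStays B m b η x0)
    (e : EpochSample n B m b) : ∀ t ≤ m, p.epochIter η x0 e t ∈ p.X
  | 0, _ => h.1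
  | t + 1, ht => by
    have := h.2 e ⟨t, ht⟩ 1 (by simp)
    rw [one_mul] at this
    rwa [← epochIter_succ] at this

/-- The assumptions on pairs of points only concern tangent vectors shorter than `ρ`; staying in `X`
along the whole retraction curve is what makes them apply to the actual step. -/
theorem EpochStays.norm_lt_rho (hp : p.Assumptions) {η : ℝ} {x0 : M}
    (h : p.EpochStays B m b η x0) (e : EpochSample n B m b) (t : Fin m) :
    ‖-(η • p.epochDir η x0 e t)‖ < p.ρ :=
  hp.norm_lt_rho fun τ hτ => by
    rw [smul_neg, smul_smul]
    exact h.2 e t τ hτ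

/-- Distance travelled by the first `t` steps of an epoch. -/
theorem EpochStays.edist_le (hp : p.Assumptions) {η : ℝ} (hη : 0 < η) {x0 : M}
    (h : p.EpochStays B m b η x0) (e : EpochSample n B m b) {a : ℕ → ℝ} (ha0 : ∀ k, 0 ≤ a k)
    (ha : ∀ k : Fin m, a k = ‖p.epochDir η x0 e k‖) :
    ∀ t ≤ m, edist x0 (p.epochIter η x0 e t) ≤
      ENNReal.ofReal (p.ν * (η * ∑ k ∈ Finset.range t, a k))
  | 0, _ => by simp [epochIter, innerLoop]
  | t + 1, ht => by
    have ih := h.edist_le hp hη e ha0 ha t (by omega)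
    have hmem := h.iter_mem e (t + 1) ht
    rw [epochIter_succ η x0 e ⟨t, ht⟩] at hmem
    have hstep := hp.dist_le_norm _ (h.iter_mem e t (by omega)) _ (h.norm_lt_rho hp e ⟨t, ht⟩) hmem
    rw [norm_neg, norm_smul, Real.norm_of_nonneg hη.le, ← ha ⟨t, ht⟩] at hstep
    have hν := hp.nu_pos.le
    rw [epochIter_succ η x0 e ⟨t, ht⟩, Finset.sum_range_succ, mul_add, mul_add,
      ENNReal.ofReal_add (mul_nonneg hν (mul_nonneg hη.le (Finset.sum_nonneg fun k _ => ha0 k)))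
        (mul_nonneg hν (mul_nonneg hη.le (ha0 t)))]
    exact (edist_triangle _ _ _).trans (add_le_add ih hstep)

/-- Inverse retractions have no triangle inequality, so the estimate passes through the metric
distance, at the price of `μν`. -/
theorem EpochStays.norm_invRetr_le (hp : p.Assumptions) {η : ℝ} (hη : 0 < η) {x0 : M}
    (h : p.EpochStays B m b η x0) (e : EpochSample n B m b) {a : ℕ → ℝ} (ha0 : ∀ k, 0 ≤ a k)
    (ha : ∀ k : Fin m, a k = ‖p.epochDir η x0 e k‖) {t : ℕ} (ht : t ≤ m) :
    ‖p.invRetr x0 (p.epochIter η x0 e t)‖ ≤ p.μ * (p.ν * (η * ∑ k ∈ Finset.range t, a k)) := by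
  have hx := h.iter_mem e t ht
  have hR := hp.retr_invRetr h.1 hx
  have h1 := hp.norm_le_dist x0 h.1 _ (hp.invRetr_mem h.1 hx) (by rwa [hR])
  rw [hR] at h1
  have hs : 0 ≤ p.ν * (η * ∑ k ∈ Finset.range t, a k) :=
    mul_nonneg hp.nu_pos.le (mul_nonneg hη.le (Finset.sum_nonneg fun k _ => ha0 k))
  have h2 := h1.trans (mul_le_mul_right (h.edist_le hp hη e ha0 ha t ht) _)
  rwa [← ENNReal.ofReal_mul hp.mu_pos.le,
    ENNReal.ofReal_le_ofReal_iff (mul_nonneg hp.mu_pos.le hs)] at h2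

/-- The drift of an epoch from its reference point is controlled by the steps. -/
theorem EpochStays.sum_sq_norm_invRetr_le (hp : p.Assumptions) {η : ℝ} (hη : 0 < η) {x0 : M}
    (h : p.EpochStays B m b η x0) (e : EpochSample n B m b) :
    ∑ t : Fin m, ‖p.invRetr x0 (p.epochIter η x0 e t)‖ ^ 2 ≤
      p.μ ^ 2 * p.ν ^ 2 * η ^ 2 * (m : ℝ) ^ 2 * ∑ t : Fin m, ‖p.epochDir η x0 e t‖ ^ 2 := by
  -- Step lengths extended by zero, so that partial sums run over `Finset.range t`.
  set a : ℕ → ℝ := fun k => if h : k < m then ‖p.epochDir η x0 e ⟨k, h⟩‖ else 0 with ha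
  have ha0 : ∀ k, 0 ≤ a k := fun k => by simp only [ha]; split_ifs <;> positivity
  have haF : ∀ k : Fin m, a k = ‖p.epochDir η x0 e k‖ := fun k => by simp [ha]
  have hsum : ∑ t : Fin m, ‖p.epochDir η x0 e t‖ ^ 2 = ∑ k ∈ Finset.range m, a k ^ 2 := by
    rw [Finset.sum_range]
    simp_rw [haF]
  have hbound (t : Fin m) : ‖p.invRetr x0 (p.epochIter η x0 e t)‖ ^ 2 ≤
      p.μ ^ 2 * p.ν ^ 2 * η ^ 2 * (m * ∑ k ∈ Finset.range m, a k ^ 2) := by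
    have h1 := h.norm_invRetr_le hp hη e ha0 haF t.2.le
    have h2 : (∑ k ∈ Finset.range t, a k) ^ 2 ≤ m * ∑ k ∈ Finset.range m, a k ^ 2 := by
      refine sq_sum_le_card_mul_sum_sq.trans ?_
      rw [Finset.card_range]
      have : (t : ℝ) ≤ m := by exact_mod_cast t.2.le
      gcongr
      exact t.2.le
    calc ‖p.invRetr x0 (p.epochIter η x0 e t)‖ ^ 2
        ≤ (p.μ * (p.ν * (η * ∑ k ∈ Finset.range t, a k))) ^ 2 := by gcongr
      _ = p.μ ^ 2 * p.ν ^ 2 * η ^ 2 * (∑ k ∈ Finset.range t, a k) ^ 2 := by ring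
      _ ≤ _ := by gcongr
  calc ∑ t : Fin m, ‖p.invRetr x0 (p.epochIter η x0 e t)‖ ^ 2
      ≤ ∑ _t : Fin m, p.μ ^ 2 * p.ν ^ 2 * η ^ 2 * (m * ∑ k ∈ Finset.range m, a k ^ 2) :=
        Finset.sum_le_sum fun t _ => hbound t
    _ = _ := by
      rw [hsum, Finset.sum_const, Finset.card_univ, Fintype.card_fin, nsmul_eq_mul]
      ring

/-- Smoothness along the step `-ηv`, with `-⟨g, v⟩` rewritten as `(‖v - g‖² - ‖g‖² - ‖v‖²) / 2`. -/
theorem EpochStays.descent (hp : p.Assumptions) {η : ℝ} {x0 : M}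
    (h : p.EpochStays B m b η x0) (e : EpochSample n B m b) (t : Fin m) :
    p.obj (p.epochIter η x0 e (t + 1)) ≤ p.obj (p.epochIter η x0 e t)
      - η / 2 * ‖(rgrad p.obj (p.epochIter η x0 e t) :
          TangentSpace 𝓘(ℝ, E) (p.epochIter η x0 e t))‖ ^ 2
      - η / 2 * (1 - p.L * η) * ‖p.epochDir η x0 e t‖ ^ 2
      + η / 2 * ‖p.epochDir η x0 e t - rgrad p.obj (p.epochIter η x0 e t)‖ ^ 2 := by
  have hmem := h.iter_mem e (t + 1) t.2
  rw [epochIter_succ] at hmem ⊢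
  have h1 := hp.retr_smooth _ (h.iter_mem e t t.2.le) _ (h.norm_lt_rho hp e t) hmem
  refine h1.trans (le_of_eq ?_)
  rw [norm_neg, norm_smul, mul_pow, Real.norm_eq_abs, sq_abs, inner_neg_right,
    real_inner_smul_right, norm_sub_sq_real, real_inner_comm]
  ring

/-- Pathwise bound on the gradients of one epoch by the decrease of the objective and the error of
the modified gradients. -/
theorem EpochStays.sum_sq_grad_le (hp : p.Assumptions) {η : ℝ} (hη : 0 < η) {x0 : M}
    (hstep : (p.Ll + p.θ * p.G) ^ 2 * p.μ ^ 2 * p.ν ^ 2 * (m : ℝ) ^ 2 / (b : ℝ) * η ^ 2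
      + p.L * η ≤ 1)
    (h : p.EpochStays B m b η x0) (e : EpochSample n B m b) :
    η / 2 * ∑ t : Fin m, ‖(rgrad p.obj (p.epochIter η x0 e t) :
          TangentSpace 𝓘(ℝ, E) (p.epochIter η x0 e t))‖ ^ 2 ≤
      p.obj x0 - p.obj (p.epochIter η x0 e m) + η / 2 * ∑ t : Fin m,
        (‖p.epochDir η x0 e t - rgrad p.obj (p.epochIter η x0 e t)‖ ^ 2 -
          (p.Ll + p.θ * p.G) ^ 2 / b * ‖p.invRetr x0 (p.epochIter η x0 e t)‖ ^ 2) := by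
  have htel : ∑ t : Fin m, (p.obj (p.epochIter η x0 e t) - p.obj (p.epochIter η x0 e (t + 1))) =
      p.obj x0 - p.obj (p.epochIter η x0 e m) := by
    rw [← Finset.sum_range (fun t => p.obj (p.epochIter η x0 e t) -
      p.obj (p.epochIter η x0 e (t + 1))), Finset.sum_range_sub']
    rfl
  have hdesc := Finset.sum_le_sum fun t (_ : t ∈ (Finset.univ : Finset (Fin m))) =>
    h.descent hp e t
  have hdrift := h.sum_sq_norm_invRetr_le hp hη e
  rw [← htel]
  simp only [Finset.sum_add_distrib, Finset.sum_sub_distrib, ← Finset.mul_sum] at hdesc ⊢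
  set Q := ∑ t : Fin m, ‖p.epochDir η x0 e t‖ ^ 2
  set D := ∑ t : Fin m, ‖p.invRetr x0 (p.epochIter η x0 e t)‖ ^ 2
  have hQ : 0 ≤ Q := Finset.sum_nonneg fun _ _ => by positivity
  -- The step-size condition enters here: the weighted drift is absorbed by the negative `‖v_t‖²`
  -- terms.
  have h1 : (p.Ll + p.θ * p.G) ^ 2 / b * D ≤ (1 - p.L * η) * Q := by
    calc (p.Ll + p.θ * p.G) ^ 2 / b * D
        ≤ (p.Ll + p.θ * p.G) ^ 2 / b * (p.μ ^ 2 * p.ν ^ 2 * η ^ 2 * (m : ℝ) ^ 2 * Q) := by gcongr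
      _ = ((p.Ll + p.θ * p.G) ^ 2 * p.μ ^ 2 * p.ν ^ 2 * (m : ℝ) ^ 2 / (b : ℝ) * η ^ 2) * Q := by
        ring
      _ ≤ _ := by gcongr; linarith
  have h2 := mul_le_mul_of_nonneg_left h1 (half_pos hη).le
  linarith

end SVRGProblem

end Epoch

/-! ### Expectations over an epoch and over a run. -/

section Expectation

variable {E : Type*} [NormedAddCommGroup E] [NormedSpace ℝ E] [FiniteDimensional ℝ E]
  {M : Type*} [EMetricSpace M] [ChartedSpace E M] [IsManifold 𝓘(ℝ, E) ∞ M]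
  [RiemannianBundle (fun x : M => TangentSpace 𝓘(ℝ, E) x)] {n B m b S : ℕ}

namespace SVRGProblem

variable {p : SVRGProblem E M n}

/-- Conditional mean-square error of the modified gradient, given the past. -/
theorem Assumptions.expect_norm_sq_direction_sub_le (hp : p.Assumptions) (hn : 1 ≤ n) (hb : 1 ≤ b)
    {x0 x : M} (hx0 : x0 ∈ p.X) (hx : x ∈ p.X) (v0 : TangentSpace 𝓘(ℝ, E) x0) :
    (Finset.expect Finset.univ fun I : Fin b → Fin n =>
      ‖(p.direction x0 v0 I x).val - rgrad p.obj x‖ ^ 2) ≤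
      (p.Ll + p.θ * p.G) ^ 2 / b * ‖p.invRetr x0 x‖ ^ 2 + ‖v0 - rgrad p.obj x0‖ ^ 2 := by
  have : NeZero n := ⟨by omega⟩
  have hb' : (b : ℝ) ≠ 0 := by positivity
  obtain ⟨U, hU⟩ := hp.transport_linear hx0 hx
  set a : Fin n → TangentSpace 𝓘(ℝ, E) x := fun i => rgrad (p.f i) x - U (rgrad (p.f i) x0) with ha
  have hmean : (1 / (n : ℝ)) • ∑ i, a i = rgrad p.obj x - U (rgrad p.obj x0) := by
    rw [hp.rgrad_obj x, hp.rgrad_obj x0, map_smul, map_sum, ← smul_sub, ← Finset.sum_sub_distrib]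
  -- Linearity of the transport separates a centred mini-batch fluctuation from the transported
  -- batch error, which does not depend on `I`.
  have hdir (I : Fin b → Fin n) : (p.direction x0 v0 I x).val - rgrad p.obj x =
      (1 / (b : ℝ)) • ∑ j, (a (I j) - (1 / (n : ℝ)) • ∑ i, a i) + U (v0 - rgrad p.obj x0) := by
    have h1 : (p.direction x0 v0 I x).val =
        (1 / (Fintype.card (Fin b) : ℝ)) • ∑ j, rgrad (p.f (I j)) x -
          p.transport x0 x ((1 / (Fintype.card (Fin b) : ℝ)) • ∑ j, rgrad (p.f (I j)) x0 - v0) :=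
      rfl
    rw [h1, hU, hmean, Finset.sum_sub_distrib, Finset.sum_const, Finset.card_univ, Fintype.card_fin,
      ← Nat.cast_smul_eq_nsmul ℝ, smul_sub (1 / (b : ℝ)) _ ((b : ℝ) • _), smul_smul,
      one_div_mul_cancel hb', one_smul, ha, Finset.sum_sub_distrib, smul_sub, map_sub, map_sub,
      map_smul, map_sum]
    abel
  simp_rw [hdir]
  rw [expect_norm_sq_miniBatch_add hb (sum_sub_mean_eq_zero hn a), U.norm_map]
  have h2 := (mean_norm_sq_sub_mean_le hn a).trans <|
    (le_of_eq (by simp only [ha, hU])).trans (hp.mean_sq_transport_le hn hx0 hx)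
  have h3 := mul_le_mul_of_nonneg_left h2 (show 0 ≤ 1 / (b : ℝ) by positivity)
  refine add_le_add_left (h3.trans (le_of_eq (by ring))) _

/-- Mean-square error of the batch gradient at the reference point. -/
theorem Assumptions.expect_norm_sq_epochGrad_sub_le (hp : p.Assumptions) (hn : 1 ≤ n) (hB : 1 ≤ B)
    (hBn : B ≤ n) {x0 : M} (hx0 : x0 ∈ p.X) :
    (Finset.expect Finset.univ fun e : EpochSample n B m b =>
      ‖(p.epochGrad e x0).val - rgrad p.obj x0‖ ^ 2) ≤ if B < n then p.σ ^ 2 / (B : ℝ) else 0 := by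
  have : NeZero n := ⟨by omega⟩
  have hB' : (B : ℝ) ≠ 0 := by positivity
  have hgrad (e : EpochSample n B m b) : (p.epochGrad e x0).val - rgrad p.obj x0 =
      (1 / (B : ℝ)) • ∑ i ∈ e.1.1, (rgrad (p.f i) x0 - rgrad p.obj x0 :
        TangentSpace 𝓘(ℝ, E) x0) := by
    have h1 : (p.epochGrad e x0).val = (1 / (Fintype.card e.1.1 : ℝ)) •
        ∑ i : e.1.1, (rgrad (p.f i) x0 : TangentSpace 𝓘(ℝ, E) x0) := rfl
    rw [h1, Fintype.card_coe, e.1.2, Finset.sum_coe_sort e.1.1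
      (fun i => (rgrad (p.f i) x0 : TangentSpace 𝓘(ℝ, E) x0)), Finset.sum_sub_distrib,
      Finset.sum_const, e.1.2, ← Nat.cast_smul_eq_nsmul ℝ, smul_sub, smul_smul,
      one_div_mul_cancel hB', one_smul]
  have h0 : ∑ i, (rgrad (p.f i) x0 - rgrad p.obj x0 : TangentSpace 𝓘(ℝ, E) x0) = 0 := by
    rw [hp.rgrad_obj x0]
    exact sum_sub_mean_eq_zero hn _
  simp_rw [hgrad]
  rw [← Finset.univ_product_univ, Finset.expect_product]
  simp only [Fintype.expect_const]
  exact expect_norm_sq_subset_le hB hBn h0 (hp.variance_bound x0 hx0)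

/-- Adaptedness: the iterate at time `t` does not see the mini-batches drawn from time `t` on, so
these can be resampled with the iterate fixed. -/
theorem innerLoop_congr {η : ℝ} {x0 : M} {v0 : TangentSpace 𝓘(ℝ, E) x0}
    {I J : Fin m → Fin b → Fin n} : ∀ {t : ℕ}, (∀ k : Fin m, (k : ℕ) < t → I k = J k) →
    p.innerLoop η x0 v0 I t = p.innerLoop η x0 v0 J t
  | 0, _ => rfl
  | t + 1, h => by
    have ih : p.innerLoop η x0 v0 I t = p.innerLoop η x0 v0 J t :=
      innerLoop_congr fun k hk => h k (by omega)
    rw [innerLoop, innerLoop, ih]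
    split_ifs with ht
    · rw [h ⟨t, ht⟩ (Nat.lt_succ_self t)]
    · rfl

theorem outerLoop_congr {η : ℝ} {xinit : M} {w w' : RunSample n B m b S} :
    ∀ {s : ℕ}, (∀ k : Fin S, (k : ℕ) < s → w k = w' k) →
    p.outerLoop η xinit w s = p.outerLoop η xinit w' s
  | 0, _ => rfl
  | s + 1, h => by
    have ih : p.outerLoop η xinit w s = p.outerLoop η xinit w' s :=
      outerLoop_congr fun k hk => h k (by omega)
    rw [outerLoop, outerLoop, ih]
    split_ifs with hs
    · rw [h ⟨s, hs⟩ (Nat.lt_succ_self s)]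
    · rfl

/-- Conditioning on everything but the mini-batch at time `t`: the iterate and `v_0` stay fixed
under its resampling, so the conditional bound applies for each value of the other choices. -/
theorem EpochStays.expect_error_le (hp : p.Assumptions) (hn : 1 ≤ n) (hb : 1 ≤ b) {η : ℝ} {x0 : M}
    (h : p.EpochStays B m b η x0) (t : Fin m) :
    (Finset.expect Finset.univ fun e : EpochSample n B m b =>
      (‖p.epochDir η x0 e t - rgrad p.obj (p.epochIter η x0 e t)‖ ^ 2 -
        (p.Ll + p.θ * p.G) ^ 2 / b * ‖p.invRetr x0 (p.epochIter η x0 e t)‖ ^ 2)) ≤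
      Finset.expect Finset.univ fun e : EpochSample n B m b =>
        ‖(p.epochGrad e x0).val - rgrad p.obj x0‖ ^ 2 := by
  classical
  have : NeZero n := ⟨by omega⟩
  rw [← Finset.univ_product_univ, Finset.expect_product, Finset.expect_product]
  refine Finset.expect_le_expect fun s _ => ?_
  rw [expect_eq_expect_expect_update _ t]
  refine Finset.expect_le_expect fun I _ => ?_
  set v0 := (p.epochGrad ((s, I) : EpochSample n B m b) x0).val with hv0
  set x := p.epochIter η x0 ((s, I) : EpochSample n B m b) t with hx
  have hxm : x ∈ p.X := h.iter_mem _ t t.2.le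
  have hiter (a : Fin b → Fin n) :
      p.epochIter η x0 ((s, Function.update I t a) : EpochSample n B m b) t = x :=
    congrArg Counted.val (innerLoop_congr fun k hk =>
      Function.update_of_ne (Fin.ne_of_lt hk) a I)
  have hterm (a : Fin b → Fin n) :
      ‖p.epochDir η x0 ((s, Function.update I t a) : EpochSample n B m b) t -
          rgrad p.obj (p.epochIter η x0 ((s, Function.update I t a) : EpochSample n B m b) t)‖ ^ 2 =
        ‖(p.direction x0 v0 a x).val - rgrad p.obj x‖ ^ 2 := by
    unfold epochDir
    rw [hiter a]
    simp only [Function.update_self]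
    rfl
  simp_rw [hterm, hiter, Finset.expect_sub_distrib, Fintype.expect_const]
  have := hp.expect_norm_sq_direction_sub_le hn hb h.1 hxm v0
  linarith

/-- Expected bound on the gradients of one epoch. -/
theorem EpochStays.expect_sum_sq_grad_le (hp : p.Assumptions) (hn : 1 ≤ n) (hB : 1 ≤ B)
    (hBn : B ≤ n) (hb : 1 ≤ b) {η : ℝ} (hη : 0 < η) {x0 : M}
    (hstep : (p.Ll + p.θ * p.G) ^ 2 * p.μ ^ 2 * p.ν ^ 2 * (m : ℝ) ^ 2 / (b : ℝ) * η ^ 2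
      + p.L * η ≤ 1)
    (h : p.EpochStays B m b η x0) :
    (Finset.expect Finset.univ fun e : EpochSample n B m b =>
      η / 2 * ∑ t : Fin m, ‖(rgrad p.obj (p.epochIter η x0 e t) :
          TangentSpace 𝓘(ℝ, E) (p.epochIter η x0 e t))‖ ^ 2) ≤
      (Finset.expect Finset.univ fun e : EpochSample n B m b =>
        (p.obj x0 - p.obj (p.epochIter η x0 e m))) +
      η / 2 * (m * if B < n then p.σ ^ 2 / (B : ℝ) else 0) := by
  refine (Finset.expect_le_expect fun e _ => h.sum_sq_grad_le hp hη hstep e).trans ?_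
  rw [Finset.expect_add_distrib, ← Finset.mul_expect, Finset.expect_sum_comm]
  gcongr
  refine (Finset.sum_le_sum fun t _ => (h.expect_error_le hp hn hb t).trans
    (hp.expect_norm_sq_epochGrad_sub_le hn hB hBn h.1)).trans (le_of_eq ?_)
  simp

/-- The reference point depends only on earlier epochs, so the sample of epoch `s` can be replaced
by an arbitrary one without moving it. -/
theorem StaysIn.epochStays {η : ℝ} {xinit : M} (h : p.StaysIn B m b S η xinit)
    (w : RunSample n B m b S) (s : Fin S) (hx : p.refPoint η xinit w s ∈ p.X) :
    p.EpochStays B m b η (p.refPoint η xinit w s) := by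
  classical
  refine ⟨hx, fun e t τ hτ => ?_⟩
  have hs := h.2 (Function.update w s e) s t τ hτ
  have href : p.refPoint η xinit (Function.update w s e) s = p.refPoint η xinit w s :=
    congrArg Counted.val (outerLoop_congr fun k hk => Function.update_of_ne (Fin.ne_of_lt hk) e w)
  unfold stepGrad iterate at hs
  rw [href, Function.update_self] at hs
  exact hs

theorem outerLoop_succ_val (η : ℝ) (xinit : M) (w : RunSample n B m b S) (s : Fin S) :
    (p.outerLoop η xinit w (s + 1)).val =
      p.epochIter η (p.refPoint η xinit w s) (w s) m := by
  rw [outerLoop]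
  simp only [s.2, dif_pos]
  rfl

theorem StaysIn.outerLoop_mem {η : ℝ} {xinit : M} (h : p.StaysIn B m b S η xinit)
    (w : RunSample n B m b S) : ∀ s ≤ S, (p.outerLoop η xinit w s).val ∈ p.X
  | 0, _ => h.1
  | s + 1, hs => by
    rw [outerLoop_succ_val η xinit w ⟨s, hs⟩]
    exact (h.epochStays w ⟨s, hs⟩ (h.outerLoop_mem w s (by omega))).iter_mem _ m le_rfl

/-- Expected bound on the gradients of epoch `s` of a run. -/
theorem StaysIn.expect_sum_sq_grad_le (hp : p.Assumptions) (hn : 1 ≤ n) (hB : 1 ≤ B)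
    (hBn : B ≤ n) (hb : 1 ≤ b) {η : ℝ} (hη : 0 < η) {xinit : M}
    (hstep : (p.Ll + p.θ * p.G) ^ 2 * p.μ ^ 2 * p.ν ^ 2 * (m : ℝ) ^ 2 / (b : ℝ) * η ^ 2
      + p.L * η ≤ 1)
    (h : p.StaysIn B m b S η xinit) (s : Fin S) :
    (Finset.expect Finset.univ fun w : RunSample n B m b S =>
      η / 2 * ∑ t : Fin m, ‖(rgrad p.obj (p.iterate η xinit w s t) :
          TangentSpace 𝓘(ℝ, E) (p.iterate η xinit w s t))‖ ^ 2) ≤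
      (Finset.expect Finset.univ fun w : RunSample n B m b S =>
        (p.obj (p.outerLoop η xinit w s).val - p.obj (p.outerLoop η xinit w (s + 1)).val)) +
      η / 2 * (m * if B < n then p.σ ^ 2 / (B : ℝ) else 0) := by
  classical
  have : NeZero n := ⟨by omega⟩
  have : Nonempty {s : Finset (Fin n) // s.card = B} := by
    obtain ⟨t, -, ht⟩ := Finset.exists_subset_card_eq
      (s := (Finset.univ : Finset (Fin n))) (n := B) (by simpa using hBn)
    exact ⟨⟨t, ht⟩⟩
  -- The constant is written below as an expectation over runs, so that the inequality can be
  -- compared run by run after resampling epoch `s`.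
  set c := η / 2 * (m * if B < n then p.σ ^ 2 / (B : ℝ) else 0)
  rw [expect_eq_expect_expect_update (fun w : RunSample n B m b S =>
      η / 2 * ∑ t : Fin m, ‖(rgrad p.obj (p.iterate η xinit w s t) :
          TangentSpace 𝓘(ℝ, E) (p.iterate η xinit w s t))‖ ^ 2) s,
    expect_eq_expect_expect_update (fun w : RunSample n B m b S =>
        (p.obj (p.outerLoop η xinit w s).val - p.obj (p.outerLoop η xinit w (s + 1)).val)) s,
    ← Fintype.expect_const (ι := RunSample n B m b S) c, ← Finset.expect_add_distrib]
  refine Finset.expect_le_expect fun w _ => ?_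
  have href (e : EpochSample n B m b) :
      p.refPoint η xinit (Function.update w s e) s = p.refPoint η xinit w s :=
    congrArg Counted.val (outerLoop_congr fun k hk => Function.update_of_ne (Fin.ne_of_lt hk) e w)
  have hstay := h.epochStays w s (h.outerLoop_mem w s s.2.le)
  have hiter (e : EpochSample n B m b) (t : Fin m) :
      p.iterate η xinit (Function.update w s e) s t =
        p.epochIter η (p.refPoint η xinit w s) e t := by
    unfold iterate
    rw [href, Function.update_self]
    rfl
  have hlast (e : EpochSample n B m b) :
      (p.outerLoop η xinit (Function.update w s e) (s + 1)).val =
        p.epochIter η (p.refPoint η xinit w s) e m := by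
    rw [outerLoop_succ_val, href, Function.update_self]
  have hfirst (e : EpochSample n B m b) :
      (p.outerLoop η xinit (Function.update w s e) s).val = p.refPoint η xinit w s := href e
  have hterm (e : EpochSample n B m b) (t : Fin m) :
      ‖(rgrad p.obj (p.iterate η xinit (Function.update w s e) s t) :
          TangentSpace 𝓘(ℝ, E) (p.iterate η xinit (Function.update w s e) s t))‖ ^ 2 =
        ‖(rgrad p.obj (p.epochIter η (p.refPoint η xinit w s) e t) :
          TangentSpace 𝓘(ℝ, E) (p.epochIter η (p.refPoint η xinit w s) e t))‖ ^ 2 := by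
    rw [hiter]
  simp_rw [hterm, hlast, hfirst]
  exact hstay.expect_sum_sq_grad_le hp hn hB hBn hb hη hstep

theorem gap_nonneg (hp : p.Assumptions) {xinit : M} (hx : xinit ∈ p.X) : 0 ≤ p.gap xinit :=
  sub_nonneg.2 (hp.optimal _ hx)

/-- Convergence in mean square for a step size satisfying the quadratic inequality. -/
theorem StaysIn.expGradNormPow_two_le (hp : p.Assumptions) (hn : 1 ≤ n) (hB : 1 ≤ B)
    (hBn : B ≤ n) (hm : 1 ≤ m) (hb : 1 ≤ b) (hS : 1 ≤ S) {η : ℝ} (hη : 0 < η) {xinit : M}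
    (hstep : (p.Ll + p.θ * p.G) ^ 2 * p.μ ^ 2 * p.ν ^ 2 * (m : ℝ) ^ 2 / (b : ℝ) * η ^ 2
      + p.L * η ≤ 1)
    (h : p.StaysIn B m b S η xinit) :
    p.expGradNormPow B m b S η xinit 2 ≤
      2 * p.gap xinit / (((S * m : ℕ) : ℝ) * η) + (if B < n then p.σ ^ 2 / (B : ℝ) else 0) := by
  have : NeZero n := ⟨by omega⟩
  have : Nonempty {s : Finset (Fin n) // s.card = B} := by
    obtain ⟨t, -, ht⟩ := Finset.exists_subset_card_eq
      (s := (Finset.univ : Finset (Fin n))) (n := B) (by simpa using hBn)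
    exact ⟨⟨t, ht⟩⟩
  set c := if B < n then p.σ ^ 2 / (B : ℝ) else 0
  have hS' : (0 : ℝ) < S := by positivity
  have hm' : (0 : ℝ) < m := by positivity
  set φ : ℕ → ℝ := fun s => Finset.expect Finset.univ fun w : RunSample n B m b S =>
    p.obj (p.outerLoop η xinit w s).val with hφ
  have hepoch := Finset.sum_le_sum fun s (_ : s ∈ (Finset.univ : Finset (Fin S))) =>
    h.expect_sum_sq_grad_le hp hn hB hBn hb hη hstep s
  have hφ0 : φ 0 = p.obj xinit := by simp [hφ, outerLoop]
  have hφS : p.obj p.xstar ≤ φ S :=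
    Finset.le_expect Finset.univ_nonempty fun w _ => hp.optimal _ (h.outerLoop_mem w S le_rfl)
  have htel : ∑ s : Fin S, (φ s - φ (s + 1)) = φ 0 - φ S := by
    rw [← Finset.sum_range (fun s => φ s - φ (s + 1)), Finset.sum_range_sub']
  simp only [Finset.expect_sub_distrib, Finset.sum_add_distrib, ← Finset.mul_expect,
    ← Finset.mul_sum, Finset.sum_const, Finset.card_univ, Fintype.card_fin, nsmul_eq_mul] at hepoch
  have hE : p.expGradNormPow B m b S η xinit 2 = 1 / ((S : ℝ) * m) *
      ∑ s : Fin S, Finset.expect Finset.univ fun w : RunSample n B m b S =>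
        ∑ t : Fin m, ‖(rgrad p.obj (p.iterate η xinit w s t) :
          TangentSpace 𝓘(ℝ, E) (p.iterate η xinit w s t))‖ ^ 2 := by
    unfold expGradNormPow
    rw [← Finset.univ_product_univ, Finset.expect_product, ← Finset.expect_sum_comm,
      Finset.mul_expect]
    refine Finset.expect_congr rfl fun w _ => ?_
    rw [Fintype.expect_eq_sum_div_card, ← Finset.univ_product_univ, Finset.sum_product,
      Fintype.card_prod, Fintype.card_fin, Fintype.card_fin]
    push_cast
    ring
  set Q := ∑ s : Fin S, Finset.expect Finset.univ fun w : RunSample n B m b S =>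
        ∑ t : Fin m, ‖(rgrad p.obj (p.iterate η xinit w s t) :
          TangentSpace 𝓘(ℝ, E) (p.iterate η xinit w s t))‖ ^ 2
  have hQ : η / 2 * Q ≤ p.gap xinit + S * (η / 2 * (m * c)) := by
    refine hepoch.trans ?_
    have h1 : ∑ s : Fin S, (φ s - φ (s + 1)) ≤ p.gap xinit := by
      rw [htel, hφ0]
      unfold gap
      linarith
    rw [show S * (η / 2 * (m * c)) = η / 2 * (m * (S * c)) by ring]
    exact add_le_add_left h1 _
  rw [hE]
  push_cast
  have h2 : Q ≤ 2 / η * (p.gap xinit + S * (η / 2 * (m * c))) := by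
    rw [div_mul_eq_mul_div, le_div_iff₀ hη]
    linarith
  calc 1 / ((S : ℝ) * m) * Q
      ≤ 1 / ((S : ℝ) * m) * (2 / η * (p.gap xinit + S * (η / 2 * (m * c)))) := by gcongr
    _ = _ := by field_simp

end SVRGProblem

end Expectation

/-! ### Step size, oracle calls and the number of epochs. -/

section Complexity

/-- With `r = √(L² + 4A)`, the difference `1 - Aη² - Lη` factors as `(2 - η(r + L)) (2 + η(r - L)) /
4`, and both factors are nonnegative. -/
theorem stepSize_quadratic_le {L A η : ℝ} (hL : 0 < L) (hA : 0 ≤ A) (hη : 0 < η)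
    (h : η ≤ 2 / (L + √(L ^ 2 + 4 * A))) : A * η ^ 2 + L * η ≤ 1 := by
  set r := √(L ^ 2 + 4 * A) with hr
  have hr2 : r ^ 2 = L ^ 2 + 4 * A := Real.sq_sqrt (by positivity)
  have hLr : L ≤ r := Real.le_sqrt_of_sq_le (by linarith)
  have hu : η * (L + r) ≤ 2 := (le_div_iff₀ (by positivity)).1 h
  have hA' : A = (r ^ 2 - L ^ 2) / 4 := by linarith
  have h1 : η * L * (2 - η * (L + r)) ≤ η * (L + r) / 2 * (2 - η * (L + r)) := by
    gcongr ?_ * _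
    nlinarith
  rw [hA']
  nlinarith

/-- A number of epochs `S` that achieves accuracy `δ`, with a bound on the cost `y ^ 3 * S`. -/
theorem exists_epochs {y D Θ δ : ℝ} (hy : 1 ≤ y) (hD : 0 ≤ D) (hΘ : 0 < Θ) (hδ : 0 < δ) :
    ∃ S : ℕ, 1 ≤ S ∧ 2 * D / (((S * ⌊y⌋₊ : ℕ) : ℝ) * (2 / Θ)) ≤ δ ∧
      y ^ 3 * S ≤ y ^ 3 + 2 * (D * Θ * y ^ 2 / δ) := by
  have hm1 : 1 ≤ ⌊y⌋₊ := Nat.le_floor (by simpa using hy)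
  have hm : (1 : ℝ) ≤ (⌊y⌋₊ : ℝ) := by exact_mod_cast hm1
  have hym : y ≤ 2 * (⌊y⌋₊ : ℝ) := by
    linarith [(Nat.lt_floor_add_one y).le]
  set m : ℝ := (⌊y⌋₊ : ℝ) with hmdef
  have hm0 : 0 < m := by linarith
  -- The accuracy requirement is equivalent to `S ≥ X`. Taking `⌊X⌋₊ + 1` rather than a ceiling
  -- keeps `S ≥ 1` even when `D = 0`.
  set X : ℝ := D * Θ / (m * δ) with hX
  have hX0 : 0 ≤ X := by positivity
  refine ⟨⌊X⌋₊ + 1, by omega, ?_, ?_⟩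
  · have hS : X ≤ ((⌊X⌋₊ + 1 : ℕ) : ℝ) := by
      push_cast
      exact (Nat.lt_floor_add_one X).le
    have hS0 : (0 : ℝ) < ((⌊X⌋₊ + 1 : ℕ) : ℝ) := by positivity
    rw [Nat.cast_mul, ← hmdef, div_le_iff₀ (by positivity)]
    rw [hX, div_le_iff₀ (by positivity)] at hS
    rw [show δ * (((⌊X⌋₊ + 1 : ℕ) : ℝ) * m * (2 / Θ)) =
      2 * (((⌊X⌋₊ + 1 : ℕ) : ℝ) * (m * δ)) / Θ by ring, le_div_iff₀ hΘ]
    linarith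
  · have hS : ((⌊X⌋₊ + 1 : ℕ) : ℝ) ≤ X + 1 := by
      push_cast
      linarith [Nat.floor_le hX0]
    have h1 : y ^ 3 * X ≤ 2 * (D * Θ * y ^ 2 / δ) := by
      have : y ^ 3 * X = D * Θ * y ^ 2 / δ * (y / m) := by
        rw [hX]; field_simp
      rw [this]
      have h2 : y / m ≤ 2 := (div_le_iff₀ hm0).2 hym
      have h3 : 0 ≤ D * Θ * y ^ 2 / δ := by positivity
      nlinarith
    calc y ^ 3 * ((⌊X⌋₊ + 1 : ℕ) : ℝ) ≤ y ^ 3 * (X + 1) := by gcongr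
      _ = y ^ 3 + y ^ 3 * X := by ring
      _ ≤ _ := by linarith

variable {E : Type*} [NormedAddCommGroup E] [NormedSpace ℝ E] [FiniteDimensional ℝ E]
  {M : Type*} [EMetricSpace M] [ChartedSpace E M] [IsManifold 𝓘(ℝ, E) ∞ M]
  [RiemannianBundle (fun x : M => TangentSpace 𝓘(ℝ, E) x)] {n B m b S : ℕ}

namespace SVRGProblem

variable {p : SVRGProblem E M n}

theorem batchGrad_calls {ι : Type} [Fintype ι] (idx : ι → Fin n) (x : M) :
    (p.batchGrad idx x).calls = Fintype.card ι := by
  simp [batchGrad, ifo]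

theorem innerLoop_calls (η : ℝ) (x0 : M) (v0 : TangentSpace 𝓘(ℝ, E) x0)
    (I : Fin m → Fin b → Fin n) : ∀ t ≤ m, (p.innerLoop η x0 v0 I t).calls = t * (2 * b)
  | 0, _ => by simp [innerLoop]
  | t + 1, ht => by
    have ih := innerLoop_calls η x0 v0 I t (by omega)
    rw [innerLoop]
    simp only [dif_pos (show t < m from ht), direction, batchGrad_calls, Fintype.card_fin, ih]
    ring

theorem outerLoop_calls (η : ℝ) (xinit : M) (w : RunSample n B m b S) :
    ∀ s ≤ S, (p.outerLoop η xinit w s).calls = s * (B + m * (2 * b))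
  | 0, _ => by simp [outerLoop]
  | s + 1, hs => by
    have ih := outerLoop_calls η xinit w s (by omega)
    rw [outerLoop]
    simp only [dif_pos (show s < S from hs), epochGrad, batchGrad_calls, Fintype.card_coe,
      (w ⟨s, hs⟩).1.2, innerLoop_calls _ _ _ _ m le_rfl, ih]
    ring

theorem totalCalls_eq (η : ℝ) (xinit : M) (w : RunSample n B m b S) :
    p.totalCalls η xinit w = S * (B + m * (2 * b)) :=
  outerLoop_calls η xinit w S le_rfl

/-- Jensen's inequality for the output gradient norm. -/
theorem expGradNormPow_one_le {η ε : ℝ} {xinit : M} (hε : 0 ≤ ε) (hn : 1 ≤ n) (hBn : B ≤ n)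
    (hm : 1 ≤ m) (hS : 1 ≤ S) (h : p.expGradNormPow B m b S η xinit 2 ≤ ε ^ 2) :
    p.expGradNormPow B m b S η xinit 1 ≤ ε := by
  have : NeZero n := ⟨by omega⟩
  have : NeZero m := ⟨by omega⟩
  have : NeZero S := ⟨by omega⟩
  have : Nonempty {s : Finset (Fin n) // s.card = B} := by
    obtain ⟨t, -, ht⟩ := Finset.exists_subset_card_eq
      (s := (Finset.univ : Finset (Fin n))) (n := B) (by simpa using hBn)
    exact ⟨⟨t, ht⟩⟩
  refine le_of_sq_le_sq ?_ hε
  refine le_trans ?_ h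
  -- Cauchy-Schwarz against the constant function 1.
  have hJ := Finset.expect_mul_sq_le_sq_mul_sq
    (Finset.univ : Finset (RunSample n B m b S × (Fin S × Fin m))) (fun _ => (1 : ℝ))
    (fun q => ‖(rgrad p.obj (p.iterate η xinit q.1 q.2.1 q.2.2) :
      TangentSpace 𝓘(ℝ, E) (p.iterate η xinit q.1 q.2.1 q.2.2))‖)
  simp only [one_mul, one_pow, Fintype.expect_const] at hJ
  simpa only [expGradNormPow, pow_one] using hJ

theorem Assumptions.Theta_pos (hp : p.Assumptions) (c : ℝ) : 0 < p.Theta c :=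
  add_pos_of_pos_of_nonneg hp.L_pos (Real.sqrt_nonneg _)

/-- The step size uses the constant 4 while the complexity bound allows any `ϱ`. With `k = 4/ϱ`, the
factor `(1 + k)²` dominates 1 and `(1 + k)² ϱ = ϱ + 8 + 4k` dominates 4. -/
theorem Assumptions.Theta_four_le (hp : p.Assumptions) {ϱ : ℝ} (hϱ : 0 < ϱ) :
    p.Theta 4 ≤ (1 + 4 / ϱ) * p.Theta ϱ := by
  have hL := hp.L_pos
  unfold Theta
  set A := (p.Ll + p.θ * p.G) ^ 2 * p.μ ^ 2 * p.ν ^ 2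
  have hA : 0 ≤ A := by positivity
  have hk : 0 < 4 / ϱ := by positivity
  have hkϱ : 4 / ϱ * ϱ = 4 := div_mul_cancel₀ _ hϱ.ne'
  have h1 : √(p.L ^ 2 + 4 * A) ≤ (1 + 4 / ϱ) * √(p.L ^ 2 + ϱ * A) := by
    refine Real.sqrt_le_iff.2 ⟨by positivity, ?_⟩
    rw [mul_pow, Real.sq_sqrt (by positivity)]
    set k := 4 / ϱ
    have h2 : (1 + k) ^ 2 * (p.L ^ 2 + ϱ * A) =
        (1 + k) ^ 2 * p.L ^ 2 + (ϱ + 2 * 4 + k * 4) * A := by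
      rw [← hkϱ]; ring
    have h3 : (1 : ℝ) ≤ (1 + k) ^ 2 := by nlinarith
    rw [h2]
    gcongr ?_ + ?_
    · nlinarith [sq_nonneg p.L]
    · gcongr
      nlinarith
  nlinarith

/-- Accuracy and cost of a run with mini-batches of size `m ^ 2`, `m = ⌊y⌋`. -/
theorem Assumptions.exists_epochs_le (hp : p.Assumptions) (hn : 1 ≤ n) (hB : 1 ≤ B)
    (hBn : B ≤ n) {y ε δ η κ ϱ : ℝ} (hϱ : 0 < ϱ) (hε : 0 < ε) (hy : 1 ≤ y) (hκ : (B : ℝ) ≤ κ * y ^ 3)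
    (hδ : 0 < δ) (hδε : δ + (if B < n then p.σ ^ 2 / (B : ℝ) else 0) ≤ ε ^ 2)
    (hm : m = ⌊y⌋₊) (hb : b = m ^ 2) (hη : η = 2 / p.Theta 4) {xinit : M}
    (hstay : ∀ S : ℕ, p.StaysIn B m b S η xinit) :
    ∃ S : ℕ, 1 ≤ S ∧ p.expGradNormPow B m b S η xinit 1 ≤ ε ∧ ∀ w : RunSample n B m b S,
      (p.totalCalls η xinit w : ℝ) ≤
        (κ + 2) * (y ^ 3 + 2 * (1 + 4 / ϱ) * (p.gap xinit * p.Theta ϱ * y ^ 2 / δ)) := by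
  have hΘ := hp.Theta_pos 4
  -- With zero epochs the staying hypothesis still says that the initial point lies in `X`.
  have hD : 0 ≤ p.gap xinit := gap_nonneg hp (hstay 0).1
  have hm1 : 1 ≤ m := hm ▸ Nat.le_floor (by simpa using hy)
  have hmy : (m : ℝ) ≤ y := hm ▸ Nat.floor_le (by linarith)
  have hm0 : (0 : ℝ) < m := by positivity
  have hb1 : 1 ≤ b := hb ▸ Nat.one_le_pow _ _ hm1
  have hη0 : 0 < η := hη ▸ div_pos two_pos hΘ
  have hmb : (m : ℝ) ^ 2 / (b : ℝ) = 1 := by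
    rw [hb]; push_cast; exact div_self (by positivity)
  have hstep : (p.Ll + p.θ * p.G) ^ 2 * p.μ ^ 2 * p.ν ^ 2 * (m : ℝ) ^ 2 / (b : ℝ) * η ^ 2
      + p.L * η ≤ 1 := by
    rw [mul_div_assoc, hmb, mul_one]
    exact stepSize_quadratic_le hp.L_pos (by positivity) hη0 hη.le
  obtain ⟨S, hS1, hSacc, hScost⟩ := exists_epochs hy hD hΘ hδ
  refine ⟨S, hS1, ?_, fun w => ?_⟩
  · refine expGradNormPow_one_le hε.le hn hBn hm1 hS1 ?_
    refine ((hstay S).expGradNormPow_two_le hp hn hB hBn hm1 hb1 hS1 hη0 hstep).trans ?_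
    rw [← hm, ← hη] at hSacc
    linarith
  · have hBpos : (0 : ℝ) < B := by positivity
    have hκ0 : 0 ≤ κ := by
      by_contra! hneg
      have : 0 < y ^ 3 := by positivity
      nlinarith
    have hcalls : (p.totalCalls η xinit w : ℝ) = S * (B + 2 * (m : ℝ) ^ 3) := by
      rw [totalCalls_eq, hb]; push_cast; ring
    have hT : p.gap xinit * p.Theta 4 * y ^ 2 / δ ≤
        (1 + 4 / ϱ) * (p.gap xinit * p.Theta ϱ * y ^ 2 / δ) := by
      calc p.gap xinit * p.Theta 4 * y ^ 2 / δ
          ≤ p.gap xinit * ((1 + 4 / ϱ) * p.Theta ϱ) * y ^ 2 / δ := by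
            gcongr; exact hp.Theta_four_le hϱ
        _ = _ := by ring
    calc (p.totalCalls η xinit w : ℝ) = S * (B + 2 * (m : ℝ) ^ 3) := hcalls
      _ ≤ S * (κ * y ^ 3 + 2 * y ^ 3) := by gcongr
      _ = (κ + 2) * (y ^ 3 * S) := by ring
      _ ≤ (κ + 2) * (y ^ 3 + 2 * (p.gap xinit * p.Theta 4 * y ^ 2 / δ)) := by gcongr
      _ ≤ (κ + 2) * (y ^ 3 + 2 * ((1 + 4 / ϱ) * (p.gap xinit * p.Theta ϱ * y ^ 2 / δ))) := by
        gcongr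
      _ = _ := by ring

end SVRGProblem

end Complexity

/-! ### Convergence and the two complexity regimes. -/

theorem mainTheorem4 (ϱ : ℝ) (hϱ : 0 < ϱ) :
    ∃ C : ℝ, 0 < C ∧
    ∀ (E : Type*) [NormedAddCommGroup E] [NormedSpace ℝ E] [FiniteDimensional ℝ E]
      (M : Type*) [EMetricSpace M] [ChartedSpace E M] [IsManifold 𝓘(ℝ, E) ∞ M]
      [RiemannianBundle (fun x : M => TangentSpace 𝓘(ℝ, E) x)]
      [IsContMDiffRiemannianBundle 𝓘(ℝ, E) ∞ E (fun x : M => TangentSpace 𝓘(ℝ, E) x)]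
      [IsRiemannianManifold 𝓘(ℝ, E) M]
      (n : ℕ) (_hn : 1 ≤ n) (p : SVRGProblem E M n) (_hp : p.Assumptions) (xinit : M),
      -- convergence
      (∀ (B m b S : ℕ) (η : ℝ), 1 ≤ B → B ≤ n → 1 ≤ m → 1 ≤ b → 1 ≤ S → 0 < η →
        η ≤ 2 / (p.L + √(p.L ^ 2 +
          4 * ((p.Ll + p.θ * p.G) ^ 2 * p.μ ^ 2 * p.ν ^ 2 * (m : ℝ) ^ 2 / (b : ℝ)))) →
        p.StaysIn B m b S η xinit →
        p.expGradNormPow B m b S η xinit 2 ≤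
          2 * p.gap xinit / (((S * m : ℕ) : ℝ) * η) + (if B < n then p.σ ^ 2 / (B : ℝ) else 0)) ∧
      -- complexity, finite-sum setting
      (∀ (ε η : ℝ) (B m b : ℕ), 0 < ε → B = n → m = ⌊(n : ℝ) ^ (1 / 3 : ℝ)⌋₊ → b = m ^ 2 →
        η = 2 / p.Theta 4 →
        (∀ S : ℕ, p.StaysIn B m b S η xinit) →
        ∃ S : ℕ, 1 ≤ S ∧ p.expGradNormPow B m b S η xinit 1 ≤ ε ∧
          ∀ w : RunSample n B m b S, (p.totalCalls η xinit w : ℝ) ≤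
            C * ((n : ℝ) + p.gap xinit * p.Theta ϱ * (n : ℝ) ^ (2 / 3 : ℝ) / ε ^ 2)) ∧
      -- complexity, online setting
      (∀ (ε η : ℝ) (B m b : ℕ), 0 < ε → ε ≤ p.σ → B = ⌈2 * p.σ ^ 2 / ε ^ 2⌉₊ → B ≤ n →
        m = ⌊(p.σ / ε) ^ (2 / 3 : ℝ)⌋₊ → b = m ^ 2 →
        η = 2 / p.Theta 4 →
        (∀ S : ℕ, p.StaysIn B m b S η xinit) →
        ∃ S : ℕ, 1 ≤ S ∧ p.expGradNormPow B m b S η xinit 1 ≤ ε ∧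
          ∀ w : RunSample n B m b S,
            (p.totalCalls η xinit w : ℝ) ≤
              C * (p.σ ^ 2 / ε ^ 2 +
                p.gap xinit * p.Theta ϱ * p.σ ^ (4 / 3 : ℝ) / ε ^ (10 / 3 : ℝ)) ∧
            (p.σ ^ (2 / 3 : ℝ) * ε ^ (4 / 3 : ℝ) ≤ p.Theta ϱ →
              (p.totalCalls η xinit w : ℝ) ≤
                C * ((1 + p.gap xinit) *
                  (p.Theta ϱ * p.σ ^ (4 / 3 : ℝ) / ε ^ (10 / 3 : ℝ))))) := by

  have hk : 1 ≤ 1 + 4 / ϱ := by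
    have : 0 < 4 / ϱ := by positivity
    linarith
  set k := 1 + 4 / ϱ with hkdef
  -- The online case dictates 20: there `κ + 2 = 5`, and `δ = ε²/2` turns `2k` into `4k`. The
  -- finite-sum case needs only `6k`.
  refine ⟨20 * k, by positivity, ?_⟩
  intro E _ _ _ M _ _ _ _ _ _ n hn p hp xinit
  refine ⟨?_, ?_, ?_⟩
  · intro B m b S η hB hBn hm hb hS hη hηle hstay
    exact hstay.expGradNormPow_two_le hp hn hB hBn hm hb hS hη
      (stepSize_quadratic_le hp.L_pos (by positivity) hη hηle)
  · intro ε η B m b hε hB hm hb hη hstay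
    subst hB
    have hn' : (1 : ℝ) ≤ B := by exact_mod_cast hn
    set y : ℝ := (B : ℝ) ^ (1 / 3 : ℝ) with hy
    have hy1 : 1 ≤ y := Real.one_le_rpow hn' (by norm_num)
    have hy3 : y ^ 3 = B := by
      rw [hy, ← Real.rpow_natCast, ← Real.rpow_mul (by positivity)]
      norm_num
    have hy2 : (B : ℝ) ^ (2 / 3 : ℝ) = y ^ 2 := by
      rw [hy, ← Real.rpow_natCast, ← Real.rpow_mul (by positivity)]
      norm_num
    obtain ⟨S, hS, hacc, hcost⟩ := hp.exists_epochs_le hn hn le_rfl (κ := 1) (δ := ε ^ 2) hϱ hε hy1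
      (by rw [hy3, one_mul]) (by positivity) (by simp) hm hb hη hstay
    refine ⟨S, hS, hacc, fun w => (hcost w).trans ?_⟩
    have hZ : 0 ≤ p.gap xinit * p.Theta ϱ * y ^ 2 / ε ^ 2 := by
      have := SVRGProblem.gap_nonneg hp (hstay 0).1
      have := hp.Theta_pos ϱ
      positivity
    rw [hy2, hy3, ← hkdef]
    set Z := p.gap xinit * p.Theta ϱ * y ^ 2 / ε ^ 2
    have h1 : 0 ≤ k * Z := by positivity
    have h2 : (B : ℝ) ≤ k * B := le_mul_of_one_le_left (by positivity) hk
    nlinarith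
  · intro ε η B m b hε hεσ hB hBn hm hb hη hstay
    have hσ : 0 < p.σ := hε.trans_le hεσ
    have hr : 1 ≤ p.σ / ε := (one_le_div hε).2 hεσ
    set y : ℝ := (p.σ / ε) ^ (2 / 3 : ℝ) with hy
    have hy1 : 1 ≤ y := Real.one_le_rpow hr (by norm_num)
    have hy3 : y ^ 3 = p.σ ^ 2 / ε ^ 2 := by
      rw [hy, ← Real.rpow_natCast, ← Real.rpow_mul (by positivity), ← div_pow,
        ← Real.rpow_natCast (p.σ / ε) 2]
      norm_num
    have hy2 : p.σ ^ (4 / 3 : ℝ) / ε ^ (10 / 3 : ℝ) = y ^ 2 / ε ^ 2 := by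
      rw [hy, ← Real.rpow_natCast, ← Real.rpow_mul (by positivity), Real.div_rpow hσ.le hε.le,
        div_div, ← Real.rpow_natCast ε 2, ← Real.rpow_add hε]
      norm_num
    have hyε : p.σ ^ (2 / 3 : ℝ) * ε ^ (4 / 3 : ℝ) = y * ε ^ 2 := by
      have : ε ^ 2 = ε ^ (2 / 3 : ℝ) * ε ^ (4 / 3 : ℝ) := by
        rw [← Real.rpow_natCast ε 2, ← Real.rpow_add hε]
        norm_num
      rw [hy, Real.div_rpow hσ.le hε.le, this, ← mul_assoc,
        div_mul_cancel₀ _ (Real.rpow_pos_of_pos hε _).ne']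
    have hBle : 2 * p.σ ^ 2 / ε ^ 2 ≤ B := hB ▸ Nat.le_ceil _
    have hBpos : (0 : ℝ) < B := lt_of_lt_of_le (by positivity) hBle
    have hB1 : 1 ≤ B := by exact_mod_cast hBpos
    -- Rounding up adds at most 1, which is at most `y³`.
    have hBκ : (B : ℝ) ≤ 3 * y ^ 3 := by
      have h1 : (B : ℝ) < 2 * p.σ ^ 2 / ε ^ 2 + 1 := hB ▸ Nat.ceil_lt_add_one (by positivity)
      have h2 : 1 ≤ y ^ 3 := one_le_pow₀ hy1
      rw [mul_div_assoc, ← hy3] at h1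
      linarith
    -- The batch size spends half of the budget `ε²` on the sampling variance; the other half is
    -- `δ`.
    have hvar : (if B < n then p.σ ^ 2 / (B : ℝ) else 0) ≤ ε ^ 2 / 2 := by
      split_ifs
      · rw [div_le_iff₀ (by positivity)] at hBle ⊢
        linarith
      · positivity
    obtain ⟨S, hS, hacc, hcost⟩ := hp.exists_epochs_le hn hB1 hBn (κ := 3) (δ := ε ^ 2 / 2) hϱ hε
      hy1 hBκ (by positivity) (by linarith) hm hb hη hstay
    have hD := SVRGProblem.gap_nonneg hp (hstay 0).1
    have hΘ := hp.Theta_pos ϱ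
    have hmain (w : RunSample n B m b S) : (p.totalCalls η xinit w : ℝ) ≤
        20 * k * (p.σ ^ 2 / ε ^ 2 +
          p.gap xinit * p.Theta ϱ * p.σ ^ (4 / 3 : ℝ) / ε ^ (10 / 3 : ℝ)) := by
      refine (hcost w).trans ?_
      have hZ : 0 ≤ p.gap xinit * p.Theta ϱ * (y ^ 2 / ε ^ 2) := by positivity
      rw [mul_div_assoc (p.gap xinit * p.Theta ϱ) (p.σ ^ (4 / 3 : ℝ)), hy2, ← hy3, ← hkdef,
        show p.gap xinit * p.Theta ϱ * y ^ 2 / (ε ^ 2 / 2) =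
          2 * (p.gap xinit * p.Theta ϱ * (y ^ 2 / ε ^ 2)) by field_simp]
      set Z := p.gap xinit * p.Theta ϱ * (y ^ 2 / ε ^ 2)
      have h1 : 0 ≤ k * Z := by positivity
      have h2 : y ^ 3 ≤ k * y ^ 3 := le_mul_of_one_le_left (by positivity) hk
      have h3 : 0 < y ^ 3 := by positivity
      nlinarith
    refine ⟨S, hS, hacc, fun w => ⟨hmain w, fun hsmall => (hmain w).trans ?_⟩⟩
    rw [mul_div_assoc (p.gap xinit * p.Theta ϱ), mul_div_assoc (p.Theta ϱ), hy2, ← hy3]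
    -- In terms of `y` the smallness condition reads `y ε² ≤ Θ`, so the batch cost is dominated by
    -- the second term.
    have h1 : y ^ 3 ≤ p.Theta ϱ * (y ^ 2 / ε ^ 2) := by
      rw [hyε] at hsmall
      calc y ^ 3 = y * ε ^ 2 * (y ^ 2 / ε ^ 2) := by field_simp
        _ ≤ _ := by gcongr
    gcongr
    linarith
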